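/- Let $\beta\in(3/2,2)$, and let $L^2(0,1)$ be the space of complex-valued square-integrable functions with inner product $(f,g)=\int_0^1 f\bar g\,dx$. Let $\widetilde H^{\beta/2}(0,1)$ $(=H_0^{\beta/2}(0,1))$ be the space of those $u\in L^2(0,1)$ whose extension by zero belongs to $H^{\beta/2}(\mathbb R)$. For $0<s<1$ denote by $${}_0D_x^{s}u=\frac{1}{\Gamma(1-s)}\frac{d}{dx}\int_0^x (x-t)^{-s}u(t)\,dt,\qquad {}_xD_1^{s}u=\frac{-1}{\Gamma(1-s)}\frac{d}{dx}\int_x^1 (t-x)^{-s}u(t)\,dt$$ the left- and right-sided Riemann--Liouville derivatives on $(0,1)$, where $d/dx$ is the weak derivative. Then ${}_0D_x^{\beta/2}\varphi$ and ${}_xD_1^{\beta/2}\varphi$ exist and lie in $L^2(0,1)$ for every $\varphi\in\widetilde H^{\beta/2}(0,1)$, so that $$A(\varphi,\psi)=-\bigl({}_0D_x^{\beta/2}\varphi,\ {}_xD_1^{\beta/2}\psi\bigr),\qquad \varphi,\psi\in\widetilde H^{\beta/2}(0,1),$$ is a well-defined sesquilinear form. Let $A$ be the operator in $L^2(0,1)$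 induced by it: $D(A)$ is the set of all $\varphi\in\widetilde H^{\beta/2}(0,1)$ for which there is an $f\in L^2(0,1)$ with $A(\varphi,\psi)=(f,\psi)$ for all $\psi\in\widetilde H^{\beta/2}(0,1)$, and then $A\varphi=f$. For every $\theta\in\bigl((2-\beta)\pi/2,\ \pi/4\bigr)$ the resolvent set $\rho(A)$, i.e. the set of all $z\in\mathbb C$ for which $zI-A:D(A)\to L^2(0,1)$ is bijective with bounded inverse, contains the sector $$\{z\in\mathbb C\setminus\{0\}:\ \theta\le|\arg z|\le\pi\},\qquad \arg z\in(-\pi,\pi].$$ -/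

import Mathlib

open MeasureTheory Set
open scoped SchwartzMap ContDiff InnerProductSpace

noncomputable section

namespace FracOp

/-- The complex Hilbert space `L²(0,1)`. -/
abbrev L2I : Type := Lp ℂ 2 (volume.restrict (Ioo (0 : ℝ) 1))

theorem memLp_zeroExt (u : L2I) :
    MemLp ((Ioo (0 : ℝ) 1).indicator (u : ℝ → ℂ)) 2 (volume : Measure ℝ) :=
  (memLp_indicator_iff_restrict measurableSet_Ioo).2 (Lp.memLp u)

/-- Extension by zero, `L²(0,1) → L²(ℝ)`. -/
def zeroExt : L2I →ₗ[ℂ] Lp ℂ 2 (volume : Measure ℝ) where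
  toFun u := (memLp_zeroExt u).toLp _
  map_add' u v := by
    rw [← MemLp.toLp_add]
    apply MemLp.toLp_congr
    have h := (ae_restrict_iff' measurableSet_Ioo).1 (Lp.coeFn_add u v)
    filter_upwards [h] with x hx
    by_cases hm : x ∈ Ioo (0 : ℝ) 1
    · simp only [indicator_of_mem hm, Pi.add_apply, hx hm]
    · simp only [indicator_of_notMem hm, Pi.add_apply, add_zero]
  map_smul' c u := by
    rw [RingHom.id_apply, ← MemLp.toLp_const_smul]
    apply MemLp.toLp_congr
    have h := (ae_restrict_iff' measurableSet_Ioo).1 (Lp.coeFn_smul c u)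
    filter_upwards [h] with x hx
    by_cases hm : x ∈ Ioo (0 : ℝ) 1
    · simp only [indicator_of_mem hm, Pi.smul_apply, hx hm]
    · simp only [indicator_of_notMem hm, Pi.smul_apply, smul_zero]

/-- The space `H̃ˢ(0,1)` of all `u ∈ L²(0,1)` whose extension by zero belongs to `Hˢ(ℝ)`. -/
def Htilde (s : ℝ) : Submodule ℂ L2I where
  carrier := {u | TemperedDistribution.MemSobolev s 2 (zeroExt u : 𝓢'(ℝ, ℂ))}
  zero_mem' := by
    simp only [mem_ofPred_eq, map_zero]
    rw [← Lp.toTemperedDistributionCLM_apply, map_zero]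
    exact TemperedDistribution.memSobolev_fun_zero ℝ ℂ s 2
  add_mem' {u v} hu hv := by
    simp only [mem_ofPred_eq] at hu hv ⊢
    rw [map_add, ← Lp.toTemperedDistributionCLM_apply, map_add]
    exact hu.add hv
  smul_mem' c u hu := by
    simp only [mem_ofPred_eq] at hu ⊢
    rw [map_smul, ← Lp.toTemperedDistributionCLM_apply, map_smul]
    exact hu.smul c

/-- Smooth real test functions with compact support in the open interval `(0,1)`. -/
def IsTest (η : ℝ → ℝ) : Prop :=
  ContDiff ℝ ∞ η ∧ HasCompactSupport η ∧ tsupport η ⊆ Ioo (0 : ℝ) 1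

/-- `g` is the weak (distributional) derivative of `F` on `(0,1)`; both are in `L¹_loc(0,1)`. -/
structure HasWeakDeriv (F g : ℝ → ℂ) : Prop where
  locInt : LocallyIntegrableOn F (Ioo (0 : ℝ) 1)
  locInt_deriv : LocallyIntegrableOn g (Ioo (0 : ℝ) 1)
  integral_eq : ∀ η : ℝ → ℝ, IsTest η →
    ∫ x in Ioo (0 : ℝ) 1, deriv η x • F x = -∫ x in Ioo (0 : ℝ) 1, η x • g x

theorem integrableOn_test_smul {χ : ℝ → ℝ} (hχ : Continuous χ) (hc : HasCompactSupport χ)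
    (hs : tsupport χ ⊆ Ioo (0 : ℝ) 1) {F : ℝ → ℂ}
    (hF : LocallyIntegrableOn F (Ioo (0 : ℝ) 1)) :
    IntegrableOn (fun x => χ x • F x) (Ioo (0 : ℝ) 1) := by
  have h1 : IntegrableOn F (tsupport χ) := hF.integrableOn_compact_subset hs hc
  have h2 : IntegrableOn (fun x => χ x • F x) (tsupport χ) :=
    h1.continuousOn_smul hχ.continuousOn hc
  have h3 : Integrable (fun x => χ x • F x) := by
    rw [← integrableOn_univ]
    refine h2.of_forall_sdiff_eq_zero MeasurableSet.univ ?_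
    intro x hx
    rw [image_eq_zero_of_notMem_tsupport hx.2, zero_smul]
  exact h3.integrableOn

theorem IsTest.integrableOn_smul {η : ℝ → ℝ} (hη : IsTest η) {F : ℝ → ℂ}
    (hF : LocallyIntegrableOn F (Ioo (0 : ℝ) 1)) :
    IntegrableOn (fun x => η x • F x) (Ioo (0 : ℝ) 1) :=
  integrableOn_test_smul hη.1.continuous hη.2.1 hη.2.2 hF

theorem IsTest.integrableOn_deriv_smul {η : ℝ → ℝ} (hη : IsTest η) {F : ℝ → ℂ}
    (hF : LocallyIntegrableOn F (Ioo (0 : ℝ) 1)) :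
    IntegrableOn (fun x => deriv η x • F x) (Ioo (0 : ℝ) 1) :=
  integrableOn_test_smul (hη.1.continuous_deriv (by simp)) hη.2.1.deriv
    (fun _ h => hη.2.2 (tsupport_deriv_subset h)) hF

theorem HasWeakDeriv.add {F G f g : ℝ → ℂ} (hF : HasWeakDeriv F f) (hG : HasWeakDeriv G g) :
    HasWeakDeriv (F + G) (f + g) := by
  refine ⟨hF.locInt.add hG.locInt, hF.locInt_deriv.add hG.locInt_deriv, fun η hη => ?_⟩
  simp only [Pi.add_apply, smul_add]
  rw [integral_add (hη.integrableOn_deriv_smul hF.locInt) (hη.integrableOn_deriv_smul hG.locInt),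
    integral_add (hη.integrableOn_smul hF.locInt_deriv) (hη.integrableOn_smul hG.locInt_deriv),
    hF.integral_eq η hη, hG.integral_eq η hη, neg_add]

theorem HasWeakDeriv.const_smul {F f : ℝ → ℂ} (hF : HasWeakDeriv F f) (c : ℂ) :
    HasWeakDeriv (c • F) (c • f) := by
  refine ⟨hF.locInt.smul c, hF.locInt_deriv.smul c, fun η hη => ?_⟩
  simp only [Pi.smul_apply, smul_comm _ c]
  rw [integral_smul, integral_smul, hF.integral_eq η hη, smul_neg]

theorem HasWeakDeriv.congr {F G f g : ℝ → ℂ} (hF : HasWeakDeriv F f)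
    (h : F =ᵐ[volume.restrict (Ioo (0 : ℝ) 1)] G) (h' : f =ᵐ[volume.restrict (Ioo (0 : ℝ) 1)] g) :
    HasWeakDeriv G g := by
  refine ⟨hF.locInt.congr h, hF.locInt_deriv.congr h', fun η hη => ?_⟩
  rw [← integral_congr_ae (h.mono fun x hx => by simp only [hx] :
      (fun x => deriv η x • F x) =ᵐ[_] fun x => deriv η x • G x), hF.integral_eq η hη,
    integral_congr_ae (h'.mono fun x hx => by simp only [hx] :
      (fun x => η x • f x) =ᵐ[_] fun x => η x • g x)]

theorem locallyIntegrableOn_L2I (u : L2I) : LocallyIntegrableOn u (Ioo (0 : ℝ) 1) :=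
  IntegrableOn.locallyIntegrableOn ((Lp.memLp u).integrable (by norm_num))

/-- The weak derivative is unique. -/
theorem HasWeakDeriv.eq_zero {F g : ℝ → ℂ} (h : HasWeakDeriv F g)
    (hF : F =ᵐ[volume.restrict (Ioo (0 : ℝ) 1)] 0) : g =ᵐ[volume.restrict (Ioo (0 : ℝ) 1)] 0 := by
  have h0 : HasWeakDeriv 0 g := h.congr hF (Filter.EventuallyEq.refl _ _)
  refine (ae_restrict_iff' measurableSet_Ioo).2 ?_
  refine isOpen_Ioo.ae_eq_zero_of_integral_contDiff_smul_eq_zero h0.locInt_deriv ?_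
  intro η h1 h2 h3
  have h4 := h0.integral_eq η ⟨h1, h2, h3⟩
  simp only [Pi.zero_apply, smul_zero, integral_zero, zero_eq_neg] at h4
  rw [← h4, setIntegral_eq_integral_of_forall_compl_eq_zero]
  intro x hx
  rw [image_eq_zero_of_notMem_tsupport (fun h => hx (h3 h)), zero_smul]

/-- The pairs `(u, g)` in `L²(0,1) × L²(0,1)` such that `g` is the weak derivative on `(0,1)` of
`x ↦ c * ∫_{J x} k x t * u t dt`, the integral being absolutely convergent for almost every `x`. -/
def weakDerivIntegralGraph (c : ℝ) (J : ℝ → Set ℝ)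
    (hJ : ∀ x ∈ Ioo (0 : ℝ) 1, J x ⊆ Ioo (0 : ℝ) 1) (k : ℝ → ℝ → ℝ) :
    Submodule ℂ (L2I × L2I) where
  carrier := {p |
    (∀ᵐ x ∂(volume.restrict (Ioo (0 : ℝ) 1)),
      IntegrableOn (fun t => k x t • (p.1 : ℝ → ℂ) t) (J x)) ∧
    HasWeakDeriv (fun x => c • ∫ t in J x, k x t • (p.1 : ℝ → ℂ) t) p.2}
  zero_mem' := by
    have hz : ∀ x ∈ Ioo (0 : ℝ) 1, (fun t => k x t • ((0 : L2I) : ℝ → ℂ) t)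
        =ᵐ[volume.restrict (J x)] fun _ => 0 := fun x hx =>
      (ae_restrict_of_ae_restrict_of_subset (hJ x hx)
        (Lp.coeFn_zero ℂ 2 (volume.restrict (Ioo (0 : ℝ) 1)))).mono fun t ht => by
        simp only [ht, Pi.zero_apply, smul_zero]
    refine ⟨(ae_restrict_iff' measurableSet_Ioo).2 (.of_forall fun x hx =>
      (integrable_zero _ _ _).congr (hz x hx).symm), ?_⟩
    have h0 : HasWeakDeriv 0 0 := ⟨integrableOn_zero.locallyIntegrableOn,
      integrableOn_zero.locallyIntegrableOn, by simp⟩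
    refine h0.congr ?_ (Lp.coeFn_zero ℂ 2 (volume.restrict (Ioo (0 : ℝ) 1))).symm
    refine (ae_restrict_iff' measurableSet_Ioo).2 (.of_forall fun x hx => ?_)
    simp only [Prod.fst_zero]
    rw [integral_congr_ae (hz x hx)]
    simp
  add_mem' {p q} hp hq := by
    have hz : ∀ x ∈ Ioo (0 : ℝ) 1, (fun t => k x t • ((p.1 + q.1 : L2I) : ℝ → ℂ) t)
        =ᵐ[volume.restrict (J x)]
          fun t => k x t • (p.1 : ℝ → ℂ) t + k x t • (q.1 : ℝ → ℂ) t := fun x hx =>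
      (ae_restrict_of_ae_restrict_of_subset (hJ x hx) (Lp.coeFn_add p.1 q.1)).mono
        fun t ht => by simp only [ht, Pi.add_apply, smul_add]
    have hm : ∀ᵐ x ∂(volume.restrict (Ioo (0 : ℝ) 1)), x ∈ Ioo (0 : ℝ) 1 :=
      ae_restrict_mem measurableSet_Ioo
    refine ⟨?_, ?_⟩
    · filter_upwards [hm, hp.1, hq.1] with x hx h1 h2
      exact (h1.add h2).congr (hz x hx).symm
    · refine (hp.2.add hq.2).congr ?_ (Lp.coeFn_add p.2 q.2).symm
      filter_upwards [hm, hp.1, hq.1] with x hx h1 h2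
      simp only [Pi.add_apply, Prod.fst_add]
      rw [integral_congr_ae (hz x hx), integral_add h1 h2, smul_add]
  smul_mem' a p hp := by
    have hz : ∀ x ∈ Ioo (0 : ℝ) 1, (fun t => k x t • ((a • p.1 : L2I) : ℝ → ℂ) t)
        =ᵐ[volume.restrict (J x)] fun t => a • (k x t • (p.1 : ℝ → ℂ) t) := fun x hx =>
      (ae_restrict_of_ae_restrict_of_subset (hJ x hx) (Lp.coeFn_smul a p.1)).mono
        fun t ht => by simp only [ht, Pi.smul_apply, smul_comm a]
    have hm : ∀ᵐ x ∂(volume.restrict (Ioo (0 : ℝ) 1)), x ∈ Ioo (0 : ℝ) 1 :=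
      ae_restrict_mem measurableSet_Ioo
    refine ⟨?_, ?_⟩
    · filter_upwards [hm, hp.1] with x hx h1
      exact (h1.smul a).congr (hz x hx).symm
    · refine (hp.2.const_smul a).congr ?_ (Lp.coeFn_smul a p.2).symm
      filter_upwards [hm] with x hx
      simp only [Pi.smul_apply, Prod.smul_fst]
      rw [integral_congr_ae (hz x hx), integral_smul, smul_comm]

/-- Such a `g` is determined by `u`. -/
theorem weakDerivIntegralGraph_snd_eq_zero (c : ℝ) (J : ℝ → Set ℝ)
    (hJ : ∀ x ∈ Ioo (0 : ℝ) 1, J x ⊆ Ioo (0 : ℝ) 1) (k : ℝ → ℝ → ℝ) (p : L2I × L2I)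
    (hp : p ∈ weakDerivIntegralGraph c J hJ k) (h0 : p.1 = 0) : p.2 = 0 := by
  refine (Lp.eq_zero_iff_ae_eq_zero).2 (hp.2.eq_zero ?_)
  refine (ae_restrict_iff' measurableSet_Ioo).2 (.of_forall fun x hx => ?_)
  have hz : (fun t => k x t • (p.1 : ℝ → ℂ) t) =ᵐ[volume.restrict (J x)] fun _ => 0 := by
    rw [h0]
    exact (ae_restrict_of_ae_restrict_of_subset (hJ x hx)
      (Lp.coeFn_zero ℂ 2 (volume.restrict (Ioo (0 : ℝ) 1)))).mono fun t ht => by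
        simp only [ht, Pi.zero_apply, smul_zero]
  simp only [Pi.zero_apply]
  rw [integral_congr_ae hz]
  simp

/-- The left-sided Riemann–Liouville derivative of order `s ∈ (0,1)` on `(0,1)`,
`u ↦ (1 / Γ(1-s)) d/dx ∫₀ˣ (x-t)^(-s) u(t) dt`, as an unbounded operator in `L²(0,1)`;
`d/dx` is the weak derivative, and the domain consists of all `u` for which it is in `L²(0,1)`. -/
def leftRL (s : ℝ) : L2I →ₗ.[ℂ] L2I :=
  (weakDerivIntegralGraph (1 / Real.Gamma (1 - s)) (fun x => Ioo 0 x)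
    (fun _ hx => Ioo_subset_Ioo_right hx.2.le) (fun x t => (x - t) ^ (-s))).toLinearPMap

/-- The right-sided Riemann–Liouville derivative of order `s ∈ (0,1)` on `(0,1)`,
`u ↦ (-1 / Γ(1-s)) d/dx ∫ₓ¹ (t-x)^(-s) u(t) dt`, as an unbounded operator in `L²(0,1)`. -/
def rightRL (s : ℝ) : L2I →ₗ.[ℂ] L2I :=
  (weakDerivIntegralGraph (-1 / Real.Gamma (1 - s)) (fun x => Ioo x 1)
    (fun _ hx => Ioo_subset_Ioo_left hx.1.le) (fun x t => (t - x) ^ (-s))).toLinearPMap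

/-- Check of the definition: membership in the graph of `leftRL`. -/
theorem mem_graph_leftRL (s : ℝ) (u g : L2I) : (u, g) ∈ (leftRL s).graph ↔
    (∀ᵐ x ∂(volume.restrict (Ioo (0 : ℝ) 1)),
      IntegrableOn (fun t => (x - t) ^ (-s) • (u : ℝ → ℂ) t) (Ioo 0 x)) ∧
    HasWeakDeriv (fun x => (1 / Real.Gamma (1 - s)) • ∫ t in Ioo 0 x,
      (x - t) ^ (-s) • (u : ℝ → ℂ) t) g := by
  rw [leftRL, Submodule.toLinearPMap_graph_eq _ (weakDerivIntegralGraph_snd_eq_zero _ _ _ _)]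
  rfl

/-- Check of the definition: membership in the graph of `rightRL`. -/
theorem mem_graph_rightRL (s : ℝ) (u g : L2I) : (u, g) ∈ (rightRL s).graph ↔
    (∀ᵐ x ∂(volume.restrict (Ioo (0 : ℝ) 1)),
      IntegrableOn (fun t => (t - x) ^ (-s) • (u : ℝ → ℂ) t) (Ioo x 1)) ∧
    HasWeakDeriv (fun x => (-1 / Real.Gamma (1 - s)) • ∫ t in Ioo x 1,
      (t - x) ^ (-s) • (u : ℝ → ℂ) t) g := by
  rw [rightRL, Submodule.toLinearPMap_graph_eq _ (weakDerivIntegralGraph_snd_eq_zero _ _ _ _)]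
  rfl

/-- The sesquilinear form `A(φ, ψ) = -(D_left^{β/2} φ, D_right^{β/2} ψ)` on `H̃^{β/2}(0,1)`, where
`(f, g) = ∫ f ḡ`. (Mathlib's `inner ℂ g f` is conjugate-linear in `g`, so it is `∫ f ḡ`.)
The arguments `hL`, `hR` say that both derivatives are defined on all of `H̃^{β/2}(0,1)`. -/
def form (β : ℝ) (hL : Htilde (β / 2) ≤ (leftRL (β / 2)).domain)
    (hR : Htilde (β / 2) ≤ (rightRL (β / 2)).domain) (φ ψ : Htilde (β / 2)) : ℂ :=
  -inner ℂ (rightRL (β / 2) ⟨ψ, hR ψ.2⟩) (leftRL (β / 2) ⟨φ, hL φ.2⟩)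

/-- The functional `A(φ, ·)` on `H̃^{β/2}(0,1)` is given by `f ∈ L²(0,1)`:
`A(φ, ψ) = (f, ψ)` for all `ψ ∈ H̃^{β/2}(0,1)`. -/
def Represents (β : ℝ) (hL : Htilde (β / 2) ≤ (leftRL (β / 2)).domain)
    (hR : Htilde (β / 2) ≤ (rightRL (β / 2)).domain) (φ : Htilde (β / 2)) (f : L2I) : Prop :=
  ∀ ψ : Htilde (β / 2), form β hL hR φ ψ = inner ℂ (ψ : L2I) f

section

variable {β : ℝ} {hL : Htilde (β / 2) ≤ (leftRL (β / 2)).domain}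
  {hR : Htilde (β / 2) ≤ (rightRL (β / 2)).domain}

theorem form_add_left (φ φ' ψ : Htilde (β / 2)) :
    form β hL hR (φ + φ') ψ = form β hL hR φ ψ + form β hL hR φ' ψ := by
  simp only [form]
  rw [← neg_add, ← inner_add_right, ← LinearPMap.map_add]
  rfl

theorem form_smul_left (a : ℂ) (φ ψ : Htilde (β / 2)) :
    form β hL hR (a • φ) ψ = a * form β hL hR φ ψ := by
  simp only [form]
  rw [mul_neg, ← inner_smul_right, ← LinearPMap.map_smul]
  rfl

theorem IsTest.memLp {η : ℝ → ℝ} (hη : IsTest η) :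
    MemLp (fun x => (η x : ℂ)) 2 (volume.restrict (Ioo (0 : ℝ) 1)) := by
  have h1 : Continuous fun x => (η x : ℂ) := Complex.continuous_ofReal.comp hη.1.continuous
  have h2 : HasCompactSupport fun x => (η x : ℂ) :=
    hη.2.1.comp_left (g := Complex.ofReal) Complex.ofReal_zero
  exact (h1.memLp_of_hasCompactSupport h2).restrict _

theorem IsTest.toLp_mem_Htilde {η : ℝ → ℝ} (hη : IsTest η) (s : ℝ) :
    hη.memLp.toLp _ ∈ Htilde s := by
  have h1 : ContDiff ℝ ∞ fun x => (η x : ℂ) := Complex.ofRealCLM.contDiff.comp hη.1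
  have h2 : HasCompactSupport fun x => (η x : ℂ) :=
    hη.2.1.comp_left (g := Complex.ofReal) Complex.ofReal_zero
  let S : 𝓢(ℝ, ℂ) := h2.toSchwartzMap h1
  have h3 : zeroExt (hη.memLp.toLp _) = S.toLp 2 := by
    refine Lp.ext ?_
    have h4 := (ae_restrict_iff' measurableSet_Ioo).1 hη.memLp.coeFn_toLp
    filter_upwards [(memLp_zeroExt (hη.memLp.toLp _)).coeFn_toLp, S.coeFn_toLp 2, h4]
      with x hx hS h4
    refine hx.trans (Eq.trans ?_ hS.symm)
    by_cases hm : x ∈ Ioo (0 : ℝ) 1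
    · rw [indicator_of_mem hm, h4 hm]
      rfl
    · rw [indicator_of_notMem hm]
      change 0 = (η x : ℂ)
      rw [image_eq_zero_of_notMem_tsupport (fun h => hm (hη.2.2 h)), Complex.ofReal_zero]
  change TemperedDistribution.MemSobolev s 2 (zeroExt (hη.memLp.toLp _) : 𝓢'(ℝ, ℂ))
  rw [h3, Lp.toTemperedDistribution_toLp_eq]
  exact S.memSobolev

/-- `f` is determined by `φ`, as `H̃^{β/2}(0,1)` is dense in `L²(0,1)`. -/
theorem Represents.eq_zero {f : L2I} (h : Represents β hL hR 0 f) : f = 0 := by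
  have h4 : ∀ ψ ∈ Htilde (β / 2), inner ℂ ψ f = 0 := by
    intro ψ hψ
    have e := form_smul_left (hL := hL) (hR := hR) 0 0 ⟨ψ, hψ⟩
    rw [zero_smul, zero_mul, h ⟨ψ, hψ⟩] at e
    exact e
  refine (Lp.eq_zero_iff_ae_eq_zero).2 ((ae_restrict_iff' measurableSet_Ioo).2 ?_)
  refine isOpen_Ioo.ae_eq_zero_of_integral_contDiff_smul_eq_zero (locallyIntegrableOn_L2I f) ?_
  intro η e1 e2 e3
  have hη : IsTest η := ⟨e1, e2, e3⟩
  have h5 := h4 _ (hη.toLp_mem_Htilde (β / 2))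
  rw [MeasureTheory.L2.inner_def] at h5
  rw [← setIntegral_eq_integral_of_forall_compl_eq_zero (s := Ioo (0 : ℝ) 1)
    (fun x hx => by rw [image_eq_zero_of_notMem_tsupport (fun h => hx (e3 h)), zero_smul]), ← h5]
  refine integral_congr_ae ?_
  filter_upwards [hη.memLp.coeFn_toLp] with x hx
  rw [hx]
  simp [mul_comm]

end

/-- The graph of the operator `A` induced by the form: all pairs `(φ, f)` with
`φ ∈ H̃^{β/2}(0,1)`, `f ∈ L²(0,1)` and `A(φ, ψ) = (f, ψ)` for all `ψ ∈ H̃^{β/2}(0,1)`. -/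
def operatorGraph (β : ℝ) (hL : Htilde (β / 2) ≤ (leftRL (β / 2)).domain)
    (hR : Htilde (β / 2) ≤ (rightRL (β / 2)).domain) : Submodule ℂ (L2I × L2I) where
  carrier := {p | ∃ φ : Htilde (β / 2), (φ : L2I) = p.1 ∧ Represents β hL hR φ p.2}
  zero_mem' := ⟨0, rfl, fun ψ => by
    have e := form_smul_left (hL := hL) (hR := hR) 0 0 ψ
    rw [zero_smul, zero_mul] at e
    rw [e]
    exact (inner_zero_right _).symm⟩
  add_mem' := by
    rintro p q ⟨φ, hp, h⟩ ⟨φ', hq, h'⟩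
    refine ⟨φ + φ', by rw [Submodule.coe_add, hp, hq, Prod.fst_add], fun ψ => ?_⟩
    rw [form_add_left, h ψ, h' ψ, Prod.snd_add, inner_add_right]
  smul_mem' := by
    rintro a p ⟨φ, hp, h⟩
    refine ⟨a • φ, by rw [Submodule.coe_smul, hp, Prod.smul_fst], fun ψ => ?_⟩
    rw [form_smul_left, h ψ, Prod.smul_snd, inner_smul_right]

/-- The operator `A : D(A) → L²(0,1)`, `D(A) ⊆ H̃^{β/2}(0,1) ⊆ L²(0,1)`, induced by the form. -/
def operator (β : ℝ) (hL : Htilde (β / 2) ≤ (leftRL (β / 2)).domain)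
    (hR : Htilde (β / 2) ≤ (rightRL (β / 2)).domain) : L2I →ₗ.[ℂ] L2I :=
  (operatorGraph β hL hR).toLinearPMap

/-- Check of the definition: `operatorGraph` is the graph of `operator`. -/
theorem graph_operator (β : ℝ) (hL : Htilde (β / 2) ≤ (leftRL (β / 2)).domain)
    (hR : Htilde (β / 2) ≤ (rightRL (β / 2)).domain) :
    (operator β hL hR).graph = operatorGraph β hL hR := by
  refine Submodule.toLinearPMap_graph_eq _ ?_
  rintro p ⟨φ, hp, h⟩ h0
  have : φ = 0 := Subtype.ext (hp.trans h0)
  subst this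
  exact h.eq_zero

/-- The resolvent set of an unbounded operator `A` in a complex normed space: all `z` for which
`z - A : D(A) → H` has a bounded inverse, defined on the whole space. -/
def resolventSet {H : Type*} [NormedAddCommGroup H] [NormedSpace ℂ H] (A : H →ₗ.[ℂ] H) : Set ℂ :=
  {z | ∃ R : H →L[ℂ] H,
    (∀ f : H, ∃ h : R f ∈ A.domain, z • R f - A ⟨R f, h⟩ = f) ∧
    ∀ u : A.domain, R (z • (u : H) - A u) = u}

end FracOp

end

/-!
Extend `u ∈ H̃ˢ(0,1)` by zero and take Fourier transforms: the left and right derivatives of order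
`s` become multiplication by `(2πiξ)ˢ` and by its complex conjugate. Only the left derivative is
supported in `[0,∞)` and only the right one in `(-∞,1]`, so pairing them over `(0,1)` is the same as
pairing them over `ℝ`, and Plancherel turns the form into `A(u,v) = -∫ (2πiξ)^{2s} û v̂*`, where the
star is complex conjugation. For `2s = β` the symbol `-(2πiξ)^β` takes its values on the two rays
`arg = ±(1 - s)π`, and its modulus dominates `(1 + ξ²)ˢ - 1`. When `(1 - s)π < |arg z|` a line
through the origin separates these rays from `z`, so after multiplication by a unimodular constant
the form of `A - z` is coercive on `H̃ˢ(0,1)`. The Lax–Milgram theorem inverts it, and composing the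
inverse with the embedding into `L²(0,1)` and its adjoint gives the bounded inverse of `z - A`.
-/

noncomputable section

namespace FracOp

open Filter Topology FourierTransform
open scoped Real

theorem integrableOn_rpow_mul_exp_neg_mul {a b : ℝ} (ha : -1 < a) (hb : 0 < b) :
    IntegrableOn (fun t : ℝ => t ^ a * Real.exp (-(b * t))) (Ioi 0) := by
  simpa using integrableOn_rpow_mul_exp_neg_mul_rpow ha one_pos hb

theorem norm_rpow_mul_cexp_neg_mul {a t : ℝ} (ht : 0 < t) (r : ℂ) :
    ‖((t ^ a : ℝ) : ℂ) * Complex.exp (-(r * t))‖ = t ^ a * Real.exp (-(r.re * t)) := by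
  rw [norm_mul, Complex.norm_real, Complex.norm_exp, Real.norm_of_nonneg (by positivity)]
  simp

theorem integrableOn_rpow_mul_cexp_neg_mul {a : ℝ} (ha : -1 < a) {r : ℂ} (hr : 0 < r.re) :
    IntegrableOn (fun t : ℝ => ((t ^ a : ℝ) : ℂ) * Complex.exp (-(r * t))) (Ioi 0) := by
  refine (integrableOn_rpow_mul_exp_neg_mul ha hr).mono' (by fun_prop) ?_
  filter_upwards [ae_restrict_mem measurableSet_Ioi] with t ht
  exact (norm_rpow_mul_cexp_neg_mul ht r).le

theorem differentiableAt_integral_rpow_mul_cexp_neg_mul {a : ℝ} (ha : -1 < a) {r : ℂ}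
    (hr : 0 < r.re) :
    DifferentiableAt ℂ (fun r : ℂ => ∫ t in Ioi (0 : ℝ),
      ((t ^ a : ℝ) : ℂ) * Complex.exp (-(r * t))) r := by
  have hnhds : {z : ℂ | r.re / 2 < z.re} ∈ 𝓝 r :=
    (isOpen_lt continuous_const Complex.continuous_re).mem_nhds (half_lt_self hr)
  refine (hasDerivAt_integral_of_dominated_loc_of_deriv_le (𝕜 := ℂ)
    (F := fun z t => ((t ^ a : ℝ) : ℂ) * Complex.exp (-(z * t)))
    (F' := fun z t => ((t ^ a : ℝ) : ℂ) * (Complex.exp (-(z * t)) * (-(t : ℂ))))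
    (bound := fun t : ℝ => t ^ (a + 1) * Real.exp (-(r.re / 2 * t))) hnhds
    (.of_forall fun z => by fun_prop) (integrableOn_rpow_mul_cexp_neg_mul ha hr) (by fun_prop)
    ?_ (integrableOn_rpow_mul_exp_neg_mul (by linarith) (half_pos hr)) ?_).2.differentiableAt
  · filter_upwards [ae_restrict_mem measurableSet_Ioi] with t (ht : 0 < t) z (hz : r.re / 2 < z.re)
    rw [← mul_assoc, norm_mul, norm_rpow_mul_cexp_neg_mul ht, norm_neg, Complex.norm_real,
      Real.norm_of_nonneg ht.le, Real.rpow_add ht, Real.rpow_one]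
    calc t ^ a * Real.exp (-(z.re * t)) * t
        ≤ t ^ a * Real.exp (-(r.re / 2 * t)) * t := by gcongr
      _ = t ^ a * t * Real.exp (-(r.re / 2 * t)) := by ring
  · refine .of_forall fun t z _ => ?_
    have hlin : HasDerivAt (fun z : ℂ => -(z * t)) (-(t : ℂ)) z := by
      simpa using ((hasDerivAt_id' z).mul_const (t : ℂ)).fun_neg
    exact hlin.cexp.const_mul _

theorem integral_rpow_mul_cexp_neg_ofReal_mul_Ioi {a r : ℝ} (ha : 0 < a) (hr : 0 < r) :
    ∫ t in Ioi (0 : ℝ), ((t ^ (a - 1) : ℝ) : ℂ) * Complex.exp (-(r * t)) =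
      Real.Gamma a * (r : ℂ) ^ (-a : ℂ) := by
  calc ∫ t in Ioi (0 : ℝ), ((t ^ (a - 1) : ℝ) : ℂ) * Complex.exp (-(r * t))
      = ((∫ t in Ioi (0 : ℝ), t ^ (a - 1) * Real.exp (-(r * t)) : ℝ) : ℂ) := by
        rw [← integral_complex_ofReal]
        simp
    _ = Real.Gamma a * (r : ℂ) ^ (-a : ℂ) := by
        rw [Real.integral_rpow_mul_exp_neg_mul_Ioi ha hr, one_div, Real.inv_rpow hr.le,
          ← Real.rpow_neg hr.le, mul_comm, Complex.ofReal_mul, Complex.ofReal_cpow hr.le,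
          Complex.ofReal_neg]

theorem integral_rpow_mul_cexp_neg_mul_Ioi {a : ℝ} (ha : 0 < a) {r : ℂ} (hr : 0 < r.re) :
    ∫ t in Ioi (0 : ℝ), ((t ^ (a - 1) : ℝ) : ℂ) * Complex.exp (-(r * t)) =
      Real.Gamma a * r ^ (-a : ℂ) := by
  have hopen : IsOpen {z : ℂ | 0 < z.re} := isOpen_lt continuous_const Complex.continuous_re
  have hlhs : AnalyticOnNhd ℂ (fun r : ℂ => ∫ t in Ioi (0 : ℝ),
      ((t ^ (a - 1) : ℝ) : ℂ) * Complex.exp (-(r * t))) {z : ℂ | 0 < z.re} :=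
    DifferentiableOn.analyticOnNhd (fun z hz => (differentiableAt_integral_rpow_mul_cexp_neg_mul
      (by linarith) hz).differentiableWithinAt) hopen
  have hrhs : AnalyticOnNhd ℂ (fun r : ℂ => Real.Gamma a * r ^ (-a : ℂ)) {z : ℂ | 0 < z.re} :=
    DifferentiableOn.analyticOnNhd (fun z hz => ((differentiableAt_id.cpow_const
      (Or.inl hz)).const_mul _).differentiableWithinAt) hopen
  refine hlhs.eqOn_of_preconnected_of_frequently_eq hrhs
    (convex_halfSpace_re_gt 0).isPreconnected (z₀ := 1) (by simp) ?_ hr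
  have hreal : Tendsto (fun x : ℝ => (x : ℂ)) (𝓝[≠] 1) (𝓝[≠] 1) :=
    Complex.continuous_ofReal.continuousWithinAt.tendsto_nhdsWithin fun x hx => by simpa using hx
  refine hreal.frequently (Eventually.frequently ?_)
  filter_upwards [nhdsWithin_le_nhds (lt_mem_nhds one_pos)] with x hx
  exact integral_rpow_mul_cexp_neg_ofReal_mul_Ioi ha hx

/-- The convolution kernel of the left-sided Riemann–Liouville integral of order `1 - s`. -/
def rlKernel (s y : ℝ) : ℝ := (Ioi (0 : ℝ)).indicator (fun y => y ^ (-s) / Real.Gamma (1 - s)) y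

theorem rlKernel_of_pos {s y : ℝ} (hy : 0 < y) : rlKernel s y = y ^ (-s) / Real.Gamma (1 - s) :=
  indicator_of_mem hy _

theorem rlKernel_of_nonpos {s y : ℝ} (hy : y ≤ 0) : rlKernel s y = 0 :=
  indicator_of_notMem (notMem_Ioi.2 hy) _

theorem rlKernel_nonneg {s : ℝ} (hs : s < 1) (y : ℝ) : 0 ≤ rlKernel s y :=
  indicator_nonneg (fun _ hy => div_nonneg (Real.rpow_nonneg (le_of_lt hy) _)
    (Real.Gamma_pos_of_pos (by linarith)).le) y

@[fun_prop]
theorem measurable_rlKernel (s : ℝ) : Measurable (rlKernel s) :=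
  Measurable.indicator (by fun_prop) measurableSet_Ioi

theorem integrable_exp_neg_mul_mul_rlKernel {s ε : ℝ} (hs : s < 1) (hε : 0 < ε) :
    Integrable fun y => Real.exp (-(ε * y)) * rlKernel s y := by
  have hIoi : IntegrableOn (fun y => Real.exp (-(ε * y)) * rlKernel s y) (Ioi 0) := by
    refine IntegrableOn.congr_fun ((integrableOn_rpow_mul_exp_neg_mul (a := -s) (by linarith)
      hε).div_const (Real.Gamma (1 - s))) (fun y hy => ?_) measurableSet_Ioi
    simp only [rlKernel_of_pos hy]
    ring
  rw [← integrableOn_univ]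
  refine hIoi.of_forall_sdiff_eq_zero MeasurableSet.univ fun y hy => ?_
  rw [rlKernel_of_nonpos (not_lt.1 hy.2), mul_zero]

theorem fourier_exp_neg_mul_mul_rlKernel {s ε : ℝ} (hs : s < 1) (hε : 0 < ε) (ξ : ℝ) :
    𝓕 (fun y => ((Real.exp (-(ε * y)) * rlKernel s y : ℝ) : ℂ)) ξ =
      ((ε : ℂ) + 2 * π * Complex.I * ξ) ^ (s - 1 : ℂ) := by
  have hΓ : (Real.Gamma (1 - s) : ℂ) ≠ 0 :=
    Complex.ofReal_ne_zero.2 (Real.Gamma_pos_of_pos (by linarith)).ne'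
  have hintegrand (y : ℝ) : Complex.exp (((-2 * π * y * ξ : ℝ) : ℂ) * Complex.I) •
      ((Real.exp (-(ε * y)) * rlKernel s y : ℝ) : ℂ) = (Ioi (0 : ℝ)).indicator (fun y : ℝ =>
        ((y ^ ((1 - s) - 1) : ℝ) : ℂ) * Complex.exp (-(((ε : ℂ) + 2 * π * Complex.I * ξ) * y)) /
          Real.Gamma (1 - s)) y := by
    rcases le_or_gt y 0 with hy | hy
    · rw [rlKernel_of_nonpos hy, indicator_of_notMem (notMem_Ioi.2 hy), mul_zero,
        Complex.ofReal_zero, smul_zero]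
    · rw [rlKernel_of_pos hy, indicator_of_mem (mem_Ioi.2 hy), smul_eq_mul, sub_sub_cancel_left,
        show -(((ε : ℂ) + 2 * π * Complex.I * ξ) * y) =
          ((-2 * π * y * ξ : ℝ) : ℂ) * Complex.I + ((-(ε * y) : ℝ) : ℂ) by push_cast; ring,
        Complex.exp_add]
      push_cast
      ring
  rw [Real.fourier_real_eq_integral_exp_smul, integral_congr_ae (.of_forall hintegrand),
    integral_indicator measurableSet_Ioi, integral_div,
    integral_rpow_mul_cexp_neg_mul_Ioi (by linarith) (by simpa using hε),
    mul_div_cancel_left₀ _ hΓ]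
  push_cast
  rw [neg_sub]

/-- The Fourier symbol of the left-sided fractional derivative of order `s` on `ℝ`, for the
normalisation `𝓕 f ξ = ∫ exp (-2πixξ) f x dx` and the principal branch of the power. -/
def fracSymbol (s ξ : ℝ) : ℂ := (2 * π * Complex.I * ξ) ^ (s : ℂ)

@[fun_prop]
theorem measurable_fracSymbol (s : ℝ) : Measurable (fracSymbol s) := by
  unfold fracSymbol
  fun_prop

theorem norm_two_pi_I_mul (ξ : ℝ) : ‖(2 * π * Complex.I * ξ : ℂ)‖ = 2 * π * |ξ| := by
  simp [abs_of_pos Real.pi_pos]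

theorem norm_fracSymbol (s ξ : ℝ) : ‖fracSymbol s ξ‖ = (2 * π * |ξ|) ^ s := by
  rw [fracSymbol, Complex.norm_cpow_real, norm_two_pi_I_mul]

theorem fracSymbol_neg (s ξ : ℝ) : fracSymbol s (-ξ) = starRingEnd ℂ (fracSymbol s ξ) := by
  have harg : (2 * π * Complex.I * ξ : ℂ).arg ≠ π := fun h => by
    simpa using (Complex.arg_eq_pi_iff.1 h).1
  have hconj : (2 * π * Complex.I * (-ξ : ℝ) : ℂ) = starRingEnd ℂ (2 * π * Complex.I * ξ) := by
    simp [Complex.conj_ofNat]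
  rw [fracSymbol, fracSymbol, hconj, Complex.conj_cpow _ _ harg, Complex.conj_ofReal]

theorem norm_mul_add_cpow_sub_one_le {s : ℝ} (hs : s ∈ Ioo (0 : ℝ) 1) (ε ξ : ℝ) :
    ‖(2 * π * Complex.I * ξ) * ((ε : ℂ) + 2 * π * Complex.I * ξ) ^ (s - 1 : ℂ)‖ ≤
      ‖fracSymbol s ξ‖ := by
  rcases eq_or_ne ξ 0 with rfl | hξ
  · simp
  have hpos : 0 < 2 * π * |ξ| := by positivity
  have him : 2 * π * |ξ| ≤ ‖(ε : ℂ) + 2 * π * Complex.I * ξ‖ := by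
    simpa [abs_mul, abs_of_pos Real.pi_pos] using
      Complex.abs_im_le_norm ((ε : ℂ) + 2 * π * Complex.I * ξ)
  rw [norm_fracSymbol, norm_mul, norm_two_pi_I_mul, ← Complex.ofReal_one, ← Complex.ofReal_sub,
    Complex.norm_cpow_real]
  calc 2 * π * |ξ| * ‖(ε : ℂ) + 2 * π * Complex.I * ξ‖ ^ (s - 1)
      ≤ 2 * π * |ξ| * (2 * π * |ξ|) ^ (s - 1) := by
        gcongr ?_ * ?_
        exact Real.rpow_le_rpow_of_nonpos hpos him (by linarith [hs.2])
    _ = (2 * π * |ξ|) ^ s := by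
        rw [Real.rpow_sub_one hpos.ne', mul_div_cancel₀ _ hpos.ne']

theorem tendsto_mul_add_cpow_sub_one {s : ℝ} (hs : 0 < s) (ξ : ℝ) :
    Tendsto (fun ε : ℝ =>
        (2 * π * Complex.I * ξ) * ((ε : ℂ) + 2 * π * Complex.I * ξ) ^ (s - 1 : ℂ)) (𝓝[>] 0)
      (𝓝 (fracSymbol s ξ)) := by
  rcases eq_or_ne ξ 0 with rfl | hξ
  · simp [fracSymbol, Complex.zero_cpow (Complex.ofReal_ne_zero.2 hs.ne')]
  set z : ℂ := 2 * π * Complex.I * ξ with hz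
  have hz0 : z ≠ 0 := by simp [hz, hξ, Real.pi_ne_zero]
  have hslit : z ∈ Complex.slitPlane := Or.inr (by simp [hz, hξ, Real.pi_ne_zero])
  have hcont : ContinuousAt (fun ε : ℝ => z * ((ε : ℂ) + z) ^ (s - 1 : ℂ)) 0 :=
    continuousAt_const.mul
      (ContinuousAt.cpow (by fun_prop) continuousAt_const (by simpa using hslit))
  have hlim := hcont.tendsto.mono_left (nhdsWithin_le_nhds (s := Ioi 0))
  rwa [Complex.ofReal_zero, zero_add, Complex.cpow_sub _ _ hz0, Complex.cpow_one,
    mul_div_cancel₀ _ hz0] at hlim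

theorem fourierInv_derivCLM_apply (f : 𝓢(ℝ, ℂ)) (ξ : ℝ) :
    𝓕⁻ (SchwartzMap.derivCLM ℂ ℂ f) ξ = -((2 * π * Complex.I * ξ) * 𝓕⁻ f ξ) := by
  have hderiv : ⇑(SchwartzMap.derivCLM ℂ ℂ f) = deriv f := rfl
  have h := congrFun (Real.fourier_deriv f.integrable f.differentiable
    (SchwartzMap.derivCLM ℂ ℂ f).integrable) (-ξ)
  rw [SchwartzMap.fourierInv_coe, SchwartzMap.fourierInv_coe, hderiv,
    Real.fourierInv_eq_fourier_neg, Real.fourierInv_eq_fourier_neg, h, smul_eq_mul]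
  push_cast
  ring

theorem integral_fourier_smul_eq {f g : ℝ → ℂ} (hf : Integrable f) (hg : Integrable g) :
    ∫ ξ, 𝓕 f ξ • g ξ = ∫ x, f x • 𝓕 g x := by
  have h := VectorFourier.integral_fourierIntegral_smul_eq_flip (L := innerₗ ℝ)
    Real.continuous_fourierChar continuous_inner hf hg
  rwa [flip_innerₗ] at h

theorem integral_smul_deriv_eq_neg_integral_fourier {κ : ℝ → ℂ} (hκ : Integrable κ)
    (f : 𝓢(ℝ, ℂ)) :
    ∫ y, κ y • deriv f y = -∫ ξ, (2 * π * Complex.I * ξ) * 𝓕 κ ξ * 𝓕⁻ f ξ := by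
  have h := integral_fourier_smul_eq hκ (𝓕⁻ (SchwartzMap.derivCLM ℂ ℂ f)).integrable
  rw [← SchwartzMap.fourier_coe, fourier_fourierInv_eq] at h
  refine h.symm.trans ?_
  rw [← integral_neg]
  refine integral_congr_ae (.of_forall fun ξ => ?_)
  simp only [fourierInv_derivCLM_apply, smul_eq_mul]
  ring

theorem rlKernel_le {s : ℝ} (hs : s ∈ Ico (0 : ℝ) 1) (y : ℝ) :
    rlKernel s y ≤
      Real.exp 1 * (Real.exp (-(1 * y)) * rlKernel s y) + 1 / Real.Gamma (1 - s) := by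
  have hΓ : 0 < Real.Gamma (1 - s) := Real.Gamma_pos_of_pos (by linarith [hs.2])
  have hk := rlKernel_nonneg hs.2 y
  rcases le_or_gt y 1 with hy | hy
  · have hexp : 1 ≤ Real.exp 1 * Real.exp (-(1 * y)) := by
      rw [← Real.exp_add]
      exact Real.one_le_exp (by linarith)
    calc rlKernel s y ≤ Real.exp 1 * Real.exp (-(1 * y)) * rlKernel s y :=
          le_mul_of_one_le_left hk hexp
      _ ≤ _ := by rw [mul_assoc]; exact le_add_of_nonneg_right (by positivity)
  · calc rlKernel s y ≤ 1 / Real.Gamma (1 - s) := by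
          rw [rlKernel_of_pos (one_pos.trans hy)]
          gcongr
          exact Real.rpow_le_one_of_one_le_of_nonpos hy.le (neg_nonpos.2 hs.1)
      _ ≤ _ := le_add_of_nonneg_left (by positivity)

theorem integrable_rlKernel_smul {s : ℝ} (hs : s ∈ Ico (0 : ℝ) 1) (f : 𝓢(ℝ, ℂ)) :
    Integrable fun y => rlKernel s y • f y := by
  have hdamped := (integrable_exp_neg_mul_mul_rlKernel hs.2 one_pos).const_mul (Real.exp 1)
  have hbound : Integrable fun y => ‖f y‖ * (Real.exp 1 * (Real.exp (-(1 * y)) * rlKernel s y)) +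
      1 / Real.Gamma (1 - s) * ‖f y‖ :=
    (hdamped.bdd_mul (by fun_prop) (.of_forall fun y => by
      simpa using f.norm_le_seminorm ℝ y)).add (f.integrable.norm.const_mul _)
  refine hbound.mono' (by fun_prop) (.of_forall fun y => ?_)
  rw [norm_smul, Real.norm_of_nonneg (rlKernel_nonneg hs.2 y)]
  calc rlKernel s y * ‖f y‖
      ≤ (Real.exp 1 * (Real.exp (-(1 * y)) * rlKernel s y) + 1 / Real.Gamma (1 - s)) * ‖f y‖ := by
        gcongr
        exact rlKernel_le hs y
    _ = _ := by ring

theorem integrableOn_rlKernel {s : ℝ} (hs : s < 1) : IntegrableOn (rlKernel s) (Ioo (-1) 1) := by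
  have h := ((integrable_exp_neg_mul_mul_rlKernel hs one_pos).const_mul
    (Real.exp 1)).integrableOn (s := Ioo (-1) 1)
  refine Integrable.mono' h (measurable_rlKernel s).aestronglyMeasurable ?_
  filter_upwards [ae_restrict_mem measurableSet_Ioo] with y hy
  rw [Real.norm_of_nonneg (rlKernel_nonneg hs y), ← mul_assoc, ← Real.exp_add]
  exact le_mul_of_one_le_left (rlKernel_nonneg hs y) (Real.one_le_exp (by linarith [hy.2]))

theorem integrable_fracSymbol_mul {s : ℝ} (hs : s ∈ Icc (0 : ℝ) 1) (f : 𝓢(ℝ, ℂ)) :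
    Integrable fun ξ => fracSymbol s ξ * f ξ := by
  have hbound : Integrable fun ξ => ‖f ξ‖ + 2 * π * (‖ξ‖ ^ 1 * ‖f ξ‖) :=
    f.integrable.norm.add ((f.integrable_pow_mul volume 1).const_mul _)
  refine hbound.mono' (by fun_prop) (.of_forall fun ξ => ?_)
  have hsymbol : ‖fracSymbol s ξ‖ ≤ 1 + 2 * π * |ξ| := by
    rw [norm_fracSymbol]
    calc (2 * π * |ξ|) ^ s ≤ (1 + 2 * π * |ξ|) ^ s :=
          Real.rpow_le_rpow (by positivity) (le_add_of_nonneg_left zero_le_one) hs.1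
      _ ≤ (1 + 2 * π * |ξ|) ^ (1 : ℝ) :=
          Real.rpow_le_rpow_of_exponent_le (le_add_of_nonneg_right (by positivity)) hs.2
      _ = 1 + 2 * π * |ξ| := Real.rpow_one _
  rw [norm_mul]
  calc ‖fracSymbol s ξ‖ * ‖f ξ‖ ≤ (1 + 2 * π * |ξ|) * ‖f ξ‖ := by gcongr
    _ = _ := by rw [Real.norm_eq_abs, pow_one]; ring

theorem tendsto_integral_exp_neg_mul_mul_rlKernel_smul {s : ℝ} (hs : s ∈ Ico (0 : ℝ) 1)
    (f : 𝓢(ℝ, ℂ)) :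
    Tendsto (fun ε : ℝ => ∫ y, ((Real.exp (-(ε * y)) * rlKernel s y : ℝ) : ℂ) • f y) (𝓝[>] 0)
      (𝓝 (∫ y, rlKernel s y • f y)) := by
  refine tendsto_integral_filter_of_dominated_convergence (fun y => ‖rlKernel s y • f y‖)
    (.of_forall fun ε => by fun_prop) ?_ (integrable_rlKernel_smul hs f).norm
    (.of_forall fun y => ?_)
  · filter_upwards [self_mem_nhdsWithin] with ε (hε : 0 < ε)
    refine .of_forall fun y => ?_
    rcases le_or_gt y 0 with hy | hy
    · simp [rlKernel_of_nonpos hy]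
    · rw [Complex.coe_smul, mul_smul, norm_smul, Real.norm_of_nonneg (Real.exp_pos _).le]
      exact mul_le_of_le_one_left (norm_nonneg _) (Real.exp_le_one_iff.2 (by nlinarith))
  · have hcont : Continuous fun ε : ℝ => ((Real.exp (-(ε * y)) * rlKernel s y : ℝ) : ℂ) • f y := by
      fun_prop
    simpa using (hcont.tendsto 0).mono_left (nhdsWithin_le_nhds (s := Ioi 0))

theorem tendsto_integral_mul_add_cpow_sub_one_mul {s : ℝ} (hs : s ∈ Ioo (0 : ℝ) 1)
    (f : 𝓢(ℝ, ℂ)) :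
    Tendsto (fun ε : ℝ => ∫ ξ : ℝ,
        (2 * π * Complex.I * ξ) * ((ε : ℂ) + 2 * π * Complex.I * ξ) ^ (s - 1 : ℂ) * f ξ) (𝓝[>] 0)
      (𝓝 (∫ ξ, fracSymbol s ξ * f ξ)) := by
  refine tendsto_integral_filter_of_dominated_convergence (fun ξ => ‖fracSymbol s ξ * f ξ‖)
    (.of_forall fun ε => ?_) (.of_forall fun ε => .of_forall fun ξ => ?_)
    (integrable_fracSymbol_mul (Ioo_subset_Icc_self hs) f).norm
    (.of_forall fun ξ => (tendsto_mul_add_cpow_sub_one hs.1 ξ).mul_const _)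
  · exact (Measurable.aestronglyMeasurable (by fun_prop)).mul (by fun_prop)
  · rw [norm_mul, norm_mul (fracSymbol s ξ)]
    gcongr
    exact norm_mul_add_cpow_sub_one_le hs ε ξ

theorem integral_rlKernel_smul_deriv {s : ℝ} (hs : s ∈ Ioo (0 : ℝ) 1) (f : 𝓢(ℝ, ℂ)) :
    ∫ y, rlKernel s y • deriv f y = -∫ ξ, fracSymbol s ξ * 𝓕⁻ f ξ := by
  refine tendsto_nhds_unique (tendsto_integral_exp_neg_mul_mul_rlKernel_smul
    (Ioo_subset_Ico_self hs) (SchwartzMap.derivCLM ℂ ℂ f)) ?_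
  refine (tendsto_integral_mul_add_cpow_sub_one_mul hs (𝓕⁻ f)).neg.congr' ?_
  filter_upwards [self_mem_nhdsWithin] with ε hε
  have hdamped := integral_smul_deriv_eq_neg_integral_fourier
    (κ := fun y => ((Real.exp (-(ε * y)) * rlKernel s y : ℝ) : ℂ))
    (integrable_exp_neg_mul_mul_rlKernel hs.2 hε).ofReal f
  simp only [fourier_exp_neg_mul_mul_rlKernel hs.2 hε] at hdamped
  exact hdamped.symm

/-- `m` is the Fourier symbol of the operator `u ↦ d/dx (k * u)`, in the dual form obtained by
letting the operator act on Schwartz functions. The kernel `k` need not be integrable at infinity;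
for functions on `(0, 1)` only its restriction to `(-1, 1)` matters. -/
structure IsDerivSymbol (k : ℝ → ℝ) (m : ℝ → ℂ) : Prop where
  integrableOn_kernel : IntegrableOn k (Ioo (-1) 1)
  integrable_mul : ∀ f : 𝓢(ℝ, ℂ), Integrable fun ξ => m ξ * f ξ
  integral_smul_deriv : ∀ f : 𝓢(ℝ, ℂ), ∫ y, k y • deriv f y = -∫ ξ, m ξ * 𝓕⁻ f ξ

theorem isDerivSymbol_rlKernel {s : ℝ} (hs : s ∈ Ioo (0 : ℝ) 1) :
    IsDerivSymbol (rlKernel s) (fracSymbol s) :=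
  ⟨integrableOn_rlKernel hs.2, integrable_fracSymbol_mul (Ioo_subset_Icc_self hs),
    integral_rlKernel_smul_deriv hs⟩

theorem IsDerivSymbol.reflect {k : ℝ → ℝ} {m : ℝ → ℂ} (h : IsDerivSymbol k m) :
    IsDerivSymbol (fun y => -k (-y)) (fun ξ => m (-ξ)) := by
  let reflection : 𝓢(ℝ, ℂ) →L[ℂ] 𝓢(ℝ, ℂ) :=
    SchwartzMap.compCLMOfContinuousLinearEquiv ℂ (ContinuousLinearEquiv.neg ℝ)
  refine ⟨?_, fun f => ?_, fun f => ?_⟩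
  · have hneg := h.integrableOn_kernel.comp_neg
    rw [Set.neg_Ioo, neg_neg] at hneg
    exact hneg.neg
  · simpa [reflection] using (h.integrable_mul (reflection f)).comp_neg
  · have hderiv (y : ℝ) : deriv (reflection f) y = -deriv f (-y) := deriv_comp_neg f y
    have hfourier (ξ : ℝ) : 𝓕⁻ (reflection f) ξ = 𝓕⁻ f (-ξ) := by
      rw [SchwartzMap.fourierInv_coe, SchwartzMap.fourierInv_coe]
      exact Real.fourierInv_comp_linearIsometry (.neg ℝ) f ξ
    have hsymbol := h.integral_smul_deriv (reflection f)
    simp only [hderiv, hfourier] at hsymbol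
    rw [← integral_neg_eq_self, ← integral_neg_eq_self (fun ξ => m (-ξ) * 𝓕⁻ f ξ)]
    simpa using hsymbol

theorem fourierInv_compSubConstCLM_apply (f : 𝓢(ℝ, ℂ)) (t ξ : ℝ) :
    𝓕⁻ (f.compSubConstCLM ℂ (-t)) ξ = Real.fourierChar (-(t * ξ)) • 𝓕⁻ f ξ := by
  have hshift : ⇑(f.compSubConstCLM ℂ (-t)) = f ∘ fun y => y + t := by
    ext y
    simp
  have hphase : innerₗ ℝ t (-ξ) = -(t * ξ) := by simp [mul_comm]
  rw [SchwartzMap.fourierInv_coe, SchwartzMap.fourierInv_coe, Real.fourierInv_eq_fourier_neg,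
    Real.fourierInv_eq_fourier_neg, hshift, ← hphase]
  exact congrFun (VectorFourier.fourierIntegral_comp_add_right Real.fourierChar volume
    (innerₗ ℝ) f t) (-ξ)

theorem IsDerivSymbol.fourier_mul_fourierInv {k : ℝ → ℝ} {m : ℝ → ℂ} (h : IsDerivSymbol k m)
    (f : 𝓢(ℝ, ℂ)) (t : ℝ) :
    𝓕 (fun ξ => m ξ * 𝓕⁻ f ξ) t = -∫ y, k y • deriv f (t + y) := by
  have hderiv (y : ℝ) : deriv (f.compSubConstCLM ℂ (-t)) y = deriv f (t + y) := by
    have hshift : ⇑(f.compSubConstCLM ℂ (-t)) = fun y => f (t + y) := by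
      ext y
      simp [add_comm]
    rw [hshift, deriv_comp_const_add]
  have hsymbol := h.integral_smul_deriv (f.compSubConstCLM ℂ (-t))
  simp only [hderiv, fourierInv_compSubConstCLM_apply] at hsymbol
  rw [hsymbol, neg_neg, Real.fourier_eq]
  refine integral_congr_ae (.of_forall fun ξ => ?_)
  simp only [RCLike.inner_apply, conj_trivial, mul_smul_comm]

theorem integral_smul_fourierInv_Lp (f : 𝓢(ℝ, ℂ)) (w : Lp ℂ 2 (volume : Measure ℝ)) :
    ∫ x, f x • (𝓕⁻ w : Lp ℂ 2 (volume : Measure ℝ)) x = ∫ ξ, 𝓕⁻ f ξ • w ξ := by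
  have h := DFunLike.congr_fun (Lp.fourierInv_toTemperedDistribution_eq w) f
  rw [TemperedDistribution.fourierInv_apply, Lp.toTemperedDistribution_apply,
    Lp.toTemperedDistribution_apply] at h
  exact h.symm

theorem integral_smul_fourier_Lp (f : 𝓢(ℝ, ℂ)) (w : Lp ℂ 2 (volume : Measure ℝ)) :
    ∫ x, f x • (𝓕 w : Lp ℂ 2 (volume : Measure ℝ)) x = ∫ ξ, 𝓕 f ξ • w ξ := by
  have h := DFunLike.congr_fun (Lp.fourier_toTemperedDistribution_eq w) f
  rw [TemperedDistribution.fourier_apply, Lp.toTemperedDistribution_apply,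
    Lp.toTemperedDistribution_apply] at h
  exact h.symm

/-- A smooth compactly supported real function as a complex Schwartz function. -/
def testSchwartz {η : ℝ → ℝ} (hη : ContDiff ℝ ∞ η) (hsupp : HasCompactSupport η) : 𝓢(ℝ, ℂ) :=
  (hsupp.comp_left (g := Complex.ofReal) Complex.ofReal_zero).toSchwartzMap
    (Complex.ofRealCLM.contDiff.comp hη)

theorem testSchwartz_apply {η : ℝ → ℝ} (hη : ContDiff ℝ ∞ η) (hsupp : HasCompactSupport η)
    (x : ℝ) : testSchwartz hη hsupp x = η x := rfl

theorem deriv_testSchwartz {η : ℝ → ℝ} (hη : ContDiff ℝ ∞ η) (hsupp : HasCompactSupport η)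
    (x : ℝ) : deriv (testSchwartz hη hsupp) x = deriv η x :=
  ((hη.differentiable (by simp)) x).hasDerivAt.ofReal_comp.deriv

theorem fourier_ae_eq_fourier_Lp {w : Lp ℂ 2 (volume : Measure ℝ)} (hw : Integrable w) :
    𝓕 (w : ℝ → ℂ) =ᵐ[volume] (𝓕 w : Lp ℂ 2 (volume : Measure ℝ)) := by
  have hcont : Continuous (𝓕 (w : ℝ → ℂ)) :=
    VectorFourier.fourierIntegral_continuous Real.continuous_fourierChar continuous_inner hw
  refine ae_eq_of_integral_contDiff_smul_eq hcont.locallyIntegrable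
    ((Lp.memLp _).locallyIntegrable (by norm_num)) fun η hη hsupp => ?_
  have h := integral_smul_fourier_Lp (testSchwartz hη hsupp) w
  rw [SchwartzMap.fourier_coe, integral_fourier_smul_eq (SchwartzMap.integrable _) hw] at h
  simpa only [testSchwartz_apply, Complex.coe_smul] using h.symm

theorem IsDerivSymbol.integral_smul_fourierInv {k : ℝ → ℝ} {m : ℝ → ℂ} (h : IsDerivSymbol k m)
    {w W : Lp ℂ 2 (volume : Measure ℝ)} (hw : Integrable w)
    (hW : W =ᵐ[volume] fun ξ => m ξ * (𝓕 w : Lp ℂ 2 (volume : Measure ℝ)) ξ) (f : 𝓢(ℝ, ℂ)) :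
    ∫ x, f x • (𝓕⁻ W : Lp ℂ 2 (volume : Measure ℝ)) x =
      -∫ t, (∫ y, k y • deriv f (t + y)) • w t := by
  calc ∫ x, f x • (𝓕⁻ W : Lp ℂ 2 (volume : Measure ℝ)) x
      = ∫ ξ, 𝓕⁻ f ξ • W ξ := integral_smul_fourierInv_Lp f W
    _ = ∫ ξ, (m ξ * 𝓕⁻ f ξ) • 𝓕 (w : ℝ → ℂ) ξ := by
        refine integral_congr_ae ?_
        filter_upwards [hW, fourier_ae_eq_fourier_Lp hw] with ξ hWξ hwξ
        rw [hWξ, hwξ, smul_eq_mul, smul_eq_mul]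
        ring
    _ = ∫ t, 𝓕 (fun ξ => m ξ * 𝓕⁻ f ξ) t • w t :=
        (integral_fourier_smul_eq (h.integrable_mul _) hw).symm
    _ = -∫ t, (∫ y, k y • deriv f (t + y)) • w t := by
        simp only [h.fourier_mul_fourierInv, neg_smul, integral_neg]

theorem coeFn_zeroExt (u : L2I) : zeroExt u =ᵐ[volume] (Ioo (0 : ℝ) 1).indicator (u : ℝ → ℂ) :=
  (memLp_zeroExt u).coeFn_toLp

theorem integrable_L2I (u : L2I) : Integrable u (volume.restrict (Ioo (0 : ℝ) 1)) :=
  (Lp.memLp u).integrable (by norm_num)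

theorem integrable_zeroExt (u : L2I) : Integrable (zeroExt u) :=
  (IntegrableOn.integrable_indicator (integrable_L2I u) measurableSet_Ioo).congr
    (coeFn_zeroExt u).symm

theorem integral_smul_zeroExt (u : L2I) (g : ℝ → ℂ) :
    ∫ t, g t • zeroExt u t = ∫ t in Ioo (0 : ℝ) 1, g t • u t := by
  rw [← integral_indicator measurableSet_Ioo]
  refine integral_congr_ae ?_
  filter_upwards [coeFn_zeroExt u] with t ht
  rw [ht, indicator_smul_apply]

/-- The restriction map `L²(ℝ) → L²(0,1)`. -/
def restrictL : Lp ℂ 2 (volume : Measure ℝ) →L[ℂ] L2I :=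
  LpToLpRestrictCLM ℝ ℂ ℂ volume 2 (Ioo (0 : ℝ) 1)

theorem coeFn_restrictL (g : Lp ℂ 2 (volume : Measure ℝ)) :
    restrictL g =ᵐ[volume.restrict (Ioo (0 : ℝ) 1)] g :=
  LpToLpRestrictCLM_coeFn ℂ _ g

theorem inner_restrictL {g h : Lp ℂ 2 (volume : Measure ℝ)}
    (hzero : ∀ᵐ x, x ∉ Ioo (0 : ℝ) 1 → g x = 0 ∨ h x = 0) :
    inner ℂ (restrictL g) (restrictL h) = inner ℂ g h := by
  rw [MeasureTheory.L2.inner_def, MeasureTheory.L2.inner_def,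
    ← setIntegral_eq_integral_of_ae_compl_eq_zero (s := Ioo (0 : ℝ) 1) (μ := volume)]
  · refine integral_congr_ae ?_
    filter_upwards [coeFn_restrictL g, coeFn_restrictL h] with x hg hh
    rw [hg, hh]
  · filter_upwards [hzero] with x hx hmem
    rcases hx hmem with h | h <;> simp [h]

theorem integrable_kernel_sub_smul {k : ℝ → ℝ} (hk : IntegrableOn k (Ioo (-1) 1)) (u : L2I) :
    Integrable (fun p : ℝ × ℝ => k (p.1 - p.2) • u p.2)
      ((volume.restrict (Ioo (0 : ℝ) 1)).prod (volume.restrict (Ioo (0 : ℝ) 1))) := by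
  have htrunc : Integrable ((Ioo (-1) 1).indicator k) := hk.integrable_indicator measurableSet_Ioo
  have hconv := (integrable_L2I u).convolution_integrand
    (ContinuousLinearMap.lsmul ℝ ℝ).flip htrunc
  refine (hconv.mono_measure (Measure.prod_mono Measure.restrict_le_self le_rfl)).congr ?_
  rw [Measure.prod_restrict]
  filter_upwards [ae_restrict_mem (measurableSet_Ioo.prod measurableSet_Ioo)] with p hp
  have hmem : p.1 - p.2 ∈ Ioo (-1 : ℝ) 1 :=
    ⟨by linarith [hp.1.1, hp.2.2], by linarith [hp.1.2, hp.2.1]⟩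
  simp only [ContinuousLinearMap.flip_apply, ContinuousLinearMap.lsmul_apply,
    indicator_of_mem hmem]

section

variable {k : ℝ → ℝ} {m : ℝ → ℂ} {u : L2I} {W : Lp ℂ 2 (volume : Measure ℝ)}

theorem IsDerivSymbol.setIntegral_deriv_smul (h : IsDerivSymbol k m)
    (hW : W =ᵐ[volume] fun ξ => m ξ * (𝓕 (zeroExt u) : Lp ℂ 2 (volume : Measure ℝ)) ξ)
    {η : ℝ → ℝ} (hη : IsTest η) :
    ∫ x in Ioo (0 : ℝ) 1, deriv η x • ∫ t in Ioo (0 : ℝ) 1, k (x - t) • u t =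
      -∫ x, η x • (𝓕⁻ W : Lp ℂ 2 (volume : Measure ℝ)) x := by
  have hderiv (x : ℝ) (hx : x ∉ Ioo (0 : ℝ) 1) : deriv η x = 0 :=
    image_eq_zero_of_notMem_tsupport fun h => hx (hη.2.2 (tsupport_deriv_subset h))
  have hinner (t : ℝ) : ∫ y, k y • deriv (testSchwartz hη.1 hη.2.1) (t + y) =
      ∫ x in Ioo (0 : ℝ) 1, ((k (x - t) * deriv η x : ℝ) : ℂ) := by
    rw [setIntegral_eq_integral_of_forall_compl_eq_zero fun x hx => by rw [hderiv x hx]; simp,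
      ← integral_add_right_eq_self (fun x => ((k (x - t) * deriv η x : ℝ) : ℂ)) t]
    refine integral_congr_ae (.of_forall fun y => ?_)
    simp only [deriv_testSchwartz, add_sub_cancel_right, add_comm t y, Complex.real_smul,
      Complex.ofReal_mul]
  have hprod : Integrable (fun p : ℝ × ℝ => deriv η p.1 • k (p.1 - p.2) • u p.2)
      ((volume.restrict (Ioo (0 : ℝ) 1)).prod (volume.restrict (Ioo (0 : ℝ) 1))) := by
    obtain ⟨C, hC⟩ := hη.2.1.deriv.exists_bound_of_continuous (hη.1.continuous_deriv (by simp))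
    exact (integrable_kernel_sub_smul h.integrableOn_kernel u).bdd_smul C
      ((hη.1.continuous_deriv (by simp)).comp continuous_fst).aestronglyMeasurable
      (.of_forall fun p => hC p.1)
  have hpair := h.integral_smul_fourierInv (integrable_zeroExt u) hW (testSchwartz hη.1 hη.2.1)
  simp only [testSchwartz_apply, Complex.coe_smul] at hpair
  rw [hpair, neg_neg, integral_smul_zeroExt]
  simp only [hinner, ← integral_smul, ← integral_smul_const]
  rw [integral_integral_swap hprod]
  simp only [Complex.ofReal_mul, smul_eq_mul, Complex.real_smul, mul_left_comm, mul_assoc]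

theorem IsDerivSymbol.hasWeakDeriv (h : IsDerivSymbol k m)
    (hW : W =ᵐ[volume] fun ξ => m ξ * (𝓕 (zeroExt u) : Lp ℂ 2 (volume : Measure ℝ)) ξ) :
    HasWeakDeriv (fun x => ∫ t in Ioo (0 : ℝ) 1, k (x - t) • u t) (restrictL (𝓕⁻ W)) := by
  refine ⟨IntegrableOn.locallyIntegrableOn
    (integrable_kernel_sub_smul h.integrableOn_kernel u).integral_prod_left,
    locallyIntegrableOn_L2I _, fun η hη => ?_⟩
  rw [h.setIntegral_deriv_smul hW hη, ← setIntegral_eq_integral_of_forall_compl_eq_zero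
    fun x hx => by rw [image_eq_zero_of_notMem_tsupport (fun h => hx (hη.2.2 h)), zero_smul]]
  refine congrArg Neg.neg (integral_congr_ae ?_)
  filter_upwards [coeFn_restrictL (𝓕⁻ W)] with x hx
  rw [hx]

theorem IsDerivSymbol.fourierInv_ae_eq_zero (h : IsDerivSymbol k m)
    (hW : W =ᵐ[volume] fun ξ => m ξ * (𝓕 (zeroExt u) : Lp ℂ 2 (volume : Measure ℝ)) ξ)
    {V : Set ℝ} (hV : IsOpen V) (hkV : ∀ t ∈ Ioo (0 : ℝ) 1, ∀ y, k y ≠ 0 → t + y ∉ V) :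
    ∀ᵐ x, x ∈ V → (𝓕⁻ W : Lp ℂ 2 (volume : Measure ℝ)) x = 0 := by
  refine hV.ae_eq_zero_of_integral_contDiff_smul_eq_zero
    (((Lp.memLp _).locallyIntegrable (by norm_num)).locallyIntegrableOn _) fun η hη hsupp hηV => ?_
  have hzero (t : ℝ) (ht : t ∈ Ioo (0 : ℝ) 1) :
      ∫ y, k y • deriv (testSchwartz hη hsupp) (t + y) = 0 := by
    refine integral_eq_zero_of_ae (.of_forall fun y => ?_)
    by_cases hy : k y = 0
    · simp [hy]
    · have hderiv : deriv η (t + y) = 0 := image_eq_zero_of_notMem_tsupport fun hmem =>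
        hkV t ht y hy (hηV (tsupport_deriv_subset hmem))
      simp [deriv_testSchwartz, hderiv]
  have hpair := h.integral_smul_fourierInv (integrable_zeroExt u) hW (testSchwartz hη hsupp)
  rw [integral_smul_zeroExt, setIntegral_congr_fun measurableSet_Ioo fun t ht => by
    rw [hzero t ht, zero_smul], integral_zero, neg_zero] at hpair
  simpa only [testSchwartz_apply, Complex.coe_smul] using hpair

theorem IsDerivSymbol.mem_weakDerivIntegralGraph (h : IsDerivSymbol k m)
    (hW : W =ᵐ[volume] fun ξ => m ξ * (𝓕 (zeroExt u) : Lp ℂ 2 (volume : Measure ℝ)) ξ)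
    {c : ℝ} (hc : c ≠ 0) {J : ℝ → Set ℝ} (hJmeas : ∀ x, MeasurableSet (J x))
    (hJ : ∀ x ∈ Ioo (0 : ℝ) 1, J x ⊆ Ioo (0 : ℝ) 1) {κ : ℝ → ℝ → ℝ}
    (hκ : ∀ x, ∀ t ∈ J x, k (x - t) = c * κ x t)
    (hzero : ∀ x, ∀ t ∈ Ioo (0 : ℝ) 1 \ J x, k (x - t) = 0) :
    (u, restrictL (𝓕⁻ W)) ∈ weakDerivIntegralGraph c J hJ κ := by
  have hsmul (x : ℝ) : EqOn (fun t => k (x - t) • u t) (fun t => c • κ x t • u t) (J x) :=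
    fun t ht => by simp only [hκ x t ht, mul_smul]
  refine ⟨?_, (h.hasWeakDeriv hW).congr ?_ (EventuallyEq.refl _ _)⟩
  · filter_upwards [ae_restrict_mem measurableSet_Ioo,
      (integrable_kernel_sub_smul h.integrableOn_kernel u).prod_right_ae] with x hx hint
    have hintJ : IntegrableOn (fun t => k (x - t) • u t) (J x) :=
      IntegrableOn.mono_set hint (hJ x hx)
    exact (integrable_fun_smul_iff hc _).1 (hintJ.congr_fun (hsmul x) (hJmeas x))
  · filter_upwards [ae_restrict_mem measurableSet_Ioo] with x hx
    rw [setIntegral_eq_of_subset_of_forall_sdiff_eq_zero measurableSet_Ioo (hJ x hx)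
      fun t ht => by rw [hzero x t ht, zero_smul],
      setIntegral_congr_fun (hJmeas x) (hsmul x), integral_smul]

end

section

variable {s : ℝ} {u v : L2I} {U V : Lp ℂ 2 (volume : Measure ℝ)}

theorem mem_graph_leftRL_of_ae_eq (hs : s ∈ Ioo (0 : ℝ) 1)
    (hU : U =ᵐ[volume] fun ξ => fracSymbol s ξ * (𝓕 (zeroExt u) : Lp ℂ 2 (volume : Measure ℝ)) ξ) :
    (u, restrictL (𝓕⁻ U)) ∈ (leftRL s).graph := by
  rw [mem_graph_leftRL]
  refine (isDerivSymbol_rlKernel hs).mem_weakDerivIntegralGraph hU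
    (one_div_ne_zero (Real.Gamma_pos_of_pos (by linarith [hs.2])).ne')
    (fun x => measurableSet_Ioo) (fun x hx => Ioo_subset_Ioo_right hx.2.le)
    (fun x t ht => ?_) fun x t ht => ?_
  · rw [rlKernel_of_pos (sub_pos.2 ht.2), div_eq_mul_one_div, mul_comm]
  · exact rlKernel_of_nonpos (sub_nonpos.2 (not_lt.1 fun htx => ht.2 ⟨ht.1.1, htx⟩))

theorem mem_graph_rightRL_of_ae_eq (hs : s ∈ Ioo (0 : ℝ) 1)
    (hV : V =ᵐ[volume]
      fun ξ => fracSymbol s (-ξ) * (𝓕 (zeroExt v) : Lp ℂ 2 (volume : Measure ℝ)) ξ) :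
    (v, restrictL (𝓕⁻ V)) ∈ (rightRL s).graph := by
  rw [mem_graph_rightRL]
  refine (isDerivSymbol_rlKernel hs).reflect.mem_weakDerivIntegralGraph hV
    (div_ne_zero (neg_ne_zero.2 one_ne_zero) (Real.Gamma_pos_of_pos (by linarith [hs.2])).ne')
    (fun x => measurableSet_Ioo) (fun x hx => Ioo_subset_Ioo_left hx.1.le)
    (fun x t ht => ?_) fun x t ht => ?_
  · rw [neg_sub, rlKernel_of_pos (sub_pos.2 ht.1)]
    ring
  · rw [neg_sub, rlKernel_of_nonpos (sub_nonpos.2 (not_lt.1 fun hxt => ht.2 ⟨hxt, ht.1.2⟩)),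
      neg_zero]

/-- The left derivative vanishes on `(-∞, 0)` and the right one on `(1, ∞)`, so their inner product
over `(0, 1)` is the one over `ℝ`, to which Plancherel applies. -/
theorem inner_restrictL_fourierInv (hs : s ∈ Ioo (0 : ℝ) 1)
    (hU : U =ᵐ[volume] fun ξ => fracSymbol s ξ * (𝓕 (zeroExt u) : Lp ℂ 2 (volume : Measure ℝ)) ξ)
    (hV : V =ᵐ[volume]
      fun ξ => fracSymbol s (-ξ) * (𝓕 (zeroExt v) : Lp ℂ 2 (volume : Measure ℝ)) ξ) :
    inner ℂ (restrictL (𝓕⁻ V)) (restrictL (𝓕⁻ U)) = inner ℂ V U := by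
  have hpos {y : ℝ} (hy : rlKernel s y ≠ 0) : 0 < y :=
    not_le.1 fun hle => hy (rlKernel_of_nonpos hle)
  have hleft := (isDerivSymbol_rlKernel hs).fourierInv_ae_eq_zero hU isOpen_Iio
    fun t ht y hy (hmem : t + y < 0) => by linarith [ht.1, hpos hy]
  have hright := (isDerivSymbol_rlKernel hs).reflect.fourierInv_ae_eq_zero hV isOpen_Ioi
    fun t ht y hy (hmem : 1 < t + y) => by linarith [ht.2, hpos (neg_ne_zero.1 hy)]
  rw [inner_restrictL]
  · exact (Lp.fourierTransformₗᵢ ℝ ℂ).symm.inner_map_map _ _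
  · filter_upwards [hleft, hright, Measure.ae_ne volume (0 : ℝ), Measure.ae_ne volume (1 : ℝ)]
      with x hleft hright hx0 hx1 hmem
    rcases lt_or_gt_of_ne hx0 with hx | hx
    · exact Or.inr (hleft hx)
    · exact Or.inl (hright (lt_of_le_of_ne (not_lt.1 fun hx' => hmem ⟨hx, hx'⟩) hx1.symm))

end

section

variable {α 𝕜 : Type*} [MeasurableSpace α] {μ : Measure α} [RCLike 𝕜] {a b m : α → 𝕜}

open Classical in
/-- Multiplication by an essentially bounded function `m` as an operator on `L²`; it is `0` if `m`
is not in `L^∞`. -/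
def mulL (μ : Measure α) (m : α → 𝕜) : Lp 𝕜 2 μ →L[𝕜] Lp 𝕜 2 μ :=
  if hm : MemLp m ⊤ μ then (ContinuousLinearMap.mul 𝕜 𝕜).holderL μ ⊤ 2 2 (hm.toLp m) else 0

theorem coeFn_mulL (hm : MemLp m ⊤ μ) (w : Lp 𝕜 2 μ) : mulL μ m w =ᵐ[μ] fun x => m x * w x := by
  rw [mulL, dif_pos hm]
  filter_upwards [(ContinuousLinearMap.mul 𝕜 𝕜).coeFn_holder (r := 2) (hm.toLp m) w,
    hm.coeFn_toLp] with x hx hmx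
  rw [← hmx]
  exact hx

theorem coeFn_mulL_mul (hb : MemLp b ⊤ μ) (hab : MemLp (a * b) ⊤ μ) (w : Lp 𝕜 2 μ) :
    mulL μ (a * b) w =ᵐ[μ] fun x => a x * mulL μ b w x := by
  filter_upwards [coeFn_mulL hab w, coeFn_mulL hb w] with x habw hbw
  rw [habw, hbw, Pi.mul_apply, mul_assoc]

theorem inner_mulL_mulL (ha : MemLp a ⊤ μ) (hb : MemLp b ⊤ μ) (v w : Lp 𝕜 2 μ) :
    inner 𝕜 (mulL μ a v) (mulL μ b w) = inner 𝕜 v (mulL μ (star a * b) w) := by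
  rw [L2.inner_def, L2.inner_def]
  refine integral_congr_ae ?_
  filter_upwards [coeFn_mulL ha v, coeFn_mulL hb w, coeFn_mulL (hb.mul ha.star) w]
    with x hav hbw habw
  rw [hav, hbw, habw]
  simp only [RCLike.inner_apply, Pi.mul_apply, Pi.star_apply, RCLike.star_def, map_mul]
  ring

theorem integral_norm_sq_eq_norm_sq (w : Lp 𝕜 2 μ) : ∫ x, ‖w x‖ ^ 2 ∂μ = ‖w‖ ^ 2 := by
  rw [← inner_self_eq_norm_sq (𝕜 := 𝕜), L2.inner_def, ← integral_re (L2.integrable_inner w w)]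
  simp only [inner_self_eq_norm_sq]

theorem mul_norm_sq_le_norm_inner_mulL (hm : MemLp m ⊤ μ) {c : ℝ} {e : 𝕜} (he : ‖e‖ = 1)
    (hc : ∀ᵐ x ∂μ, c ≤ RCLike.re (e * m x)) (w : Lp 𝕜 2 μ) :
    c * ‖w‖ ^ 2 ≤ ‖inner 𝕜 w (mulL μ m w)‖ := by
  have hint : Integrable (fun x => e * inner 𝕜 (w x) (mulL μ m w x)) μ :=
    (L2.integrable_inner w (mulL μ m w)).const_mul e
  calc c * ‖w‖ ^ 2 = ∫ x, c * ‖w x‖ ^ 2 ∂μ := by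
        rw [integral_const_mul, integral_norm_sq_eq_norm_sq]
    _ ≤ ∫ x, RCLike.re (e * inner 𝕜 (w x) (mulL μ m w x)) ∂μ := by
        refine integral_mono_ae
          (((Lp.memLp w).integrable_norm_pow (by norm_num)).const_mul c) hint.re ?_
        filter_upwards [hc, coeFn_mulL hm w] with x hx hmw
        have hpt : e * inner 𝕜 (w x) (mulL μ m w x) = e * m x * (‖w x‖ ^ 2 : ℝ) := by
          rw [hmw, RCLike.inner_apply, mul_assoc (m x), RCLike.mul_conj, mul_assoc]
          push_cast
          rfl
        rw [hpt, RCLike.re_mul_ofReal]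
        gcongr
    _ = RCLike.re (e * inner 𝕜 w (mulL μ m w)) := by
        rw [L2.inner_def, ← integral_const_mul, integral_re hint]
    _ ≤ ‖e * inner 𝕜 w (mulL μ m w)‖ := RCLike.re_le_norm _
    _ = ‖inner 𝕜 w (mulL μ m w)‖ := by rw [norm_mul, he, one_mul]

end

section

variable {𝕜 E : Type*} [RCLike 𝕜] [NormedAddCommGroup E] [InnerProductSpace 𝕜 E] [CompleteSpace E]
  (K : Submodule 𝕜 E) [CompleteSpace K]

/-- The compression `P T|_K` of the operator `T` to the subspace `K`, where `P` is the orthogonal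
projection onto `K`. -/
def compression (T : E →L[𝕜] E) : K →L[𝕜] K :=
  ContinuousLinearMap.adjoint K.subtypeL ∘L T ∘L K.subtypeL

theorem inner_compression (T : E →L[𝕜] E) (v w : K) :
    inner 𝕜 v (compression K T w) = inner 𝕜 (v : E) (T w) := by
  rw [compression, ContinuousLinearMap.comp_apply, ContinuousLinearMap.adjoint_inner_right]
  rfl

theorem isUnit_compression {T : E →L[𝕜] E} {c : ℝ} (hc : 0 < c)
    (hT : ∀ w ∈ K, c * ‖w‖ ^ 2 ≤ ‖inner 𝕜 w (T w)‖) : IsUnit (compression K T) := by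
  refine ContinuousLinearMap.isUnit_of_forall_le_norm_inner_map _ (c := ⟨c, hc.le⟩) hc fun w => ?_
  rw [norm_inner_symm, inner_compression, mul_comm]
  exact hT w w.2

end

/-- The weight `(1 + ξ²)^(-s/2)`, the Fourier symbol of the Bessel potential of order `s`. -/
def bessel (s ξ : ℝ) : ℂ := ((1 + ‖ξ‖ ^ 2) ^ (-s / 2) : ℝ)

theorem hasTemperateGrowth_bessel (s : ℝ) : (bessel s).HasTemperateGrowth := by
  unfold bessel
  fun_prop

theorem norm_bessel (s ξ : ℝ) : ‖bessel s ξ‖ = (1 + ‖ξ‖ ^ 2) ^ (-s / 2) := by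
  rw [bessel, Complex.norm_real, Real.norm_of_nonneg (by positivity)]

theorem star_bessel (s : ℝ) : star (bessel s) = bessel s :=
  funext fun _ => Complex.conj_ofReal _

theorem bessel_sq (s ξ : ℝ) : bessel s ξ ^ 2 = ((1 + ξ ^ 2) ^ (-s) : ℝ) := by
  rw [bessel, ← Complex.ofReal_pow, ← Real.rpow_mul_natCast (by positivity), Real.norm_eq_abs,
    sq_abs, Nat.cast_ofNat, div_mul_cancel₀ _ two_ne_zero]

theorem bessel_mul_bessel_neg (s : ℝ) : bessel s * bessel (-s) = fun _ => 1 := by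
  ext ξ
  rw [Pi.mul_apply, bessel, bessel, ← Complex.ofReal_mul, ← Real.rpow_add (by positivity),
    ← add_div, add_neg_cancel, zero_div, Real.rpow_zero, Complex.ofReal_one]

theorem memLp_bessel {s : ℝ} (hs : 0 ≤ s) : MemLp (bessel s) ⊤ (volume : Measure ℝ) :=
  memLp_top_of_bound (hasTemperateGrowth_bessel s).1.continuous.aestronglyMeasurable 1
    (.of_forall fun ξ => by
      rw [norm_bessel]
      exact Real.rpow_le_one_of_one_le_of_nonpos (le_add_of_nonneg_right (by positivity))
        (by linarith))

theorem norm_fracSymbol_mul_bessel_le {s : ℝ} (hs : 0 ≤ s) (ξ : ℝ) :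
    ‖(fracSymbol s * bessel s) ξ‖ ≤ (2 * π) ^ s := by
  have hrpow : |ξ| ^ s ≤ (1 + ‖ξ‖ ^ 2) ^ (s / 2) := by
    rw [Real.rpow_div_two_eq_sqrt _ (by positivity)]
    gcongr
    exact Real.le_sqrt_of_sq_le (by simp)
  rw [Pi.mul_apply, norm_mul, norm_fracSymbol, norm_bessel,
    Real.mul_rpow (by positivity) (abs_nonneg _), mul_assoc]
  refine mul_le_of_le_one_right (by positivity) ?_
  rwa [neg_div, Real.rpow_neg (by positivity), ← div_eq_mul_inv, div_le_one (by positivity)]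

theorem memLp_fracSymbol_mul_bessel {s : ℝ} (hs : 0 ≤ s) :
    MemLp (fracSymbol s * bessel s) ⊤ (volume : Measure ℝ) :=
  memLp_top_of_bound ((measurable_fracSymbol s).aestronglyMeasurable.mul
    (hasTemperateGrowth_bessel s).1.continuous.aestronglyMeasurable) _
    (.of_forall (norm_fracSymbol_mul_bessel_le hs))

theorem star_fracSymbol_mul_bessel (s : ℝ) :
    star (fracSymbol s * bessel s) = (fun ξ => fracSymbol s (-ξ)) * bessel s := by
  ext ξ
  rw [star_mul', star_bessel, Pi.mul_apply, Pi.mul_apply, fracSymbol_neg]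
  rfl

theorem toTemperedDistribution_mulL {m : ℝ → ℂ} (hm : m.HasTemperateGrowth)
    (hm' : MemLp m ⊤ (volume : Measure ℝ)) (w : Lp ℂ 2 (volume : Measure ℝ)) :
    (mulL volume m w : 𝓢'(ℝ, ℂ)) = TemperedDistribution.smulLeftCLM ℂ m w := by
  rw [← Lp.toTemperedDistribution_smul_eq (r := 2) hm hm', mulL, dif_pos hm']
  rfl

theorem mem_Htilde_iff {s : ℝ} (hs : 0 ≤ s) (u : L2I) :
    u ∈ Htilde s ↔ ∃ w, mulL volume (bessel s) w = 𝓕 (zeroExt u) := by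
  have hweight : (fun ξ : ℝ => (((1 + ‖ξ‖ ^ 2) ^ (s / 2) : ℝ) : ℂ)) = bessel (-s) := by
    ext ξ
    rw [bessel, neg_neg]
  change TemperedDistribution.MemSobolev s 2 (zeroExt u : 𝓢'(ℝ, ℂ)) ↔ _
  rw [TemperedDistribution.memSobolev_iff_exists_smulLeftCLM_fourier, hweight]
  refine exists_congr fun w => ?_
  rw [Lp.fourier_toTemperedDistribution_eq]
  refine ⟨fun h => ?_, fun h => ?_⟩
  · refine LinearMap.ker_eq_bot.1 (Lp.ker_toTemperedDistributionCLM_eq_bot (F := ℂ)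
      (μ := (volume : Measure ℝ)) (p := 2)) ?_
    change (mulL volume (bessel s) w : 𝓢'(ℝ, ℂ)) =
      (𝓕 (zeroExt u) : Lp ℂ 2 (volume : Measure ℝ))
    rw [toTemperedDistribution_mulL (hasTemperateGrowth_bessel s) (memLp_bessel hs), ← h,
      TemperedDistribution.smulLeftCLM_smulLeftCLM_apply (hasTemperateGrowth_bessel _)
        (hasTemperateGrowth_bessel s), mul_comm, bessel_mul_bessel_neg]
    simp
  · rw [← h, toTemperedDistribution_mulL (hasTemperateGrowth_bessel s) (memLp_bessel hs),
      TemperedDistribution.smulLeftCLM_smulLeftCLM_apply (hasTemperateGrowth_bessel s)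
        (hasTemperateGrowth_bessel _), bessel_mul_bessel_neg]
    simp

section

variable {s : ℝ} {u v : L2I} {w : Lp ℂ 2 (volume : Measure ℝ)}

theorem mulL_fracSymbol_mul_bessel_ae_eq (hs : 0 ≤ s)
    (hw : mulL volume (bessel s) w = 𝓕 (zeroExt u)) :
    mulL volume (fracSymbol s * bessel s) w =ᵐ[volume]
      fun ξ => fracSymbol s ξ * (𝓕 (zeroExt u) : Lp ℂ 2 (volume : Measure ℝ)) ξ := by
  rw [← hw]
  exact coeFn_mulL_mul (memLp_bessel hs) (memLp_fracSymbol_mul_bessel hs) w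

theorem mulL_star_fracSymbol_mul_bessel_ae_eq (hs : 0 ≤ s)
    (hw : mulL volume (bessel s) w = 𝓕 (zeroExt u)) :
    mulL volume (star (fracSymbol s * bessel s)) w =ᵐ[volume]
      fun ξ => fracSymbol s (-ξ) * (𝓕 (zeroExt u) : Lp ℂ 2 (volume : Measure ℝ)) ξ := by
  have hstar := (memLp_fracSymbol_mul_bessel hs).star
  rw [star_fracSymbol_mul_bessel] at hstar ⊢
  rw [← hw]
  exact coeFn_mulL_mul (memLp_bessel hs) hstar w

theorem Htilde_le_domain_leftRL (hs : s ∈ Ioo (0 : ℝ) 1) : Htilde s ≤ (leftRL s).domain := by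
  intro u hu
  obtain ⟨w, hw⟩ := (mem_Htilde_iff hs.1.le u).1 hu
  exact LinearPMap.mem_domain_of_mem_graph
    (mem_graph_leftRL_of_ae_eq hs (mulL_fracSymbol_mul_bessel_ae_eq hs.1.le hw))

theorem Htilde_le_domain_rightRL (hs : s ∈ Ioo (0 : ℝ) 1) : Htilde s ≤ (rightRL s).domain := by
  intro u hu
  obtain ⟨w, hw⟩ := (mem_Htilde_iff hs.1.le u).1 hu
  exact LinearPMap.mem_domain_of_mem_graph
    (mem_graph_rightRL_of_ae_eq hs (mulL_star_fracSymbol_mul_bessel_ae_eq hs.1.le hw))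

end

theorem form_eq {β : ℝ} (hs : β / 2 ∈ Ioo (0 : ℝ) 1)
    (hL : Htilde (β / 2) ≤ (leftRL (β / 2)).domain)
    (hR : Htilde (β / 2) ≤ (rightRL (β / 2)).domain) (φ ψ : Htilde (β / 2))
    {v w : Lp ℂ 2 (volume : Measure ℝ)} (hw : mulL volume (bessel (β / 2)) w = 𝓕 (zeroExt φ))
    (hv : mulL volume (bessel (β / 2)) v = 𝓕 (zeroExt ψ)) :
    form β hL hR φ ψ =
      -inner ℂ (mulL volume (star (fracSymbol (β / 2) * bessel (β / 2))) v)
        (mulL volume (fracSymbol (β / 2) * bessel (β / 2)) w) := by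
  have hU := mulL_fracSymbol_mul_bessel_ae_eq hs.1.le hw
  have hV := mulL_star_fracSymbol_mul_bessel_ae_eq hs.1.le hv
  rw [form, ← (LinearPMap.image_iff (hL φ.2)).2 (mem_graph_leftRL_of_ae_eq hs hU),
    ← (LinearPMap.image_iff (hR ψ.2)).2 (mem_graph_rightRL_of_ae_eq hs hV),
    inner_restrictL_fourierInv hs hU hV]

/-- The function on `ℝ` with Fourier transform `bessel s * w`. -/
def besselInv (s : ℝ) : Lp ℂ 2 (volume : Measure ℝ) →L[ℂ] Lp ℂ 2 (volume : Measure ℝ) :=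
  ((Lp.fourierTransformₗᵢ ℝ ℂ).symm : Lp ℂ 2 (volume : Measure ℝ) →L[ℂ]
    Lp ℂ 2 (volume : Measure ℝ)) ∘L mulL volume (bessel s)

theorem besselInv_apply (s : ℝ) (w : Lp ℂ 2 (volume : Measure ℝ)) :
    besselInv s w = 𝓕⁻ (mulL volume (bessel s) w) := rfl

/-- The space of all `w` for which `besselInv s w` vanishes outside `(0,1)`: a copy of
`H̃ˢ(0,1)`, normed as a closed subspace of `L²(ℝ)`. -/
def besselSpace (s : ℝ) : Submodule ℂ (Lp ℂ 2 (volume : Measure ℝ)) :=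
  (LpToLpRestrictCLM ℝ ℂ ℂ volume 2 (Ioo (0 : ℝ) 1)ᶜ ∘L besselInv s).ker

instance (s : ℝ) : CompleteSpace (besselSpace s) :=
  (ContinuousLinearMap.isClosed_ker _).completeSpace_coe

/-- The element of `H̃ˢ(0,1)` that corresponds to `w`. -/
def ofBessel (s : ℝ) : besselSpace s →L[ℂ] L2I :=
  restrictL ∘L besselInv s ∘L (besselSpace s).subtypeL

theorem ofBessel_apply {s : ℝ} (w : besselSpace s) : ofBessel s w = restrictL (besselInv s w) := rfl

theorem mem_besselSpace_iff {s : ℝ} {w : Lp ℂ 2 (volume : Measure ℝ)} :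
    w ∈ besselSpace s ↔ ∀ᵐ x, x ∉ Ioo (0 : ℝ) 1 → besselInv s w x = 0 := by
  have hcoe := LpToLpRestrictCLM_coeFn (p := 2) ℂ (Ioo (0 : ℝ) 1)ᶜ (besselInv s w)
  rw [besselSpace, LinearMap.mem_ker, ContinuousLinearMap.coe_coe, ContinuousLinearMap.comp_apply,
    Lp.eq_zero_iff_ae_eq_zero]
  exact Iff.trans ⟨hcoe.symm.trans, hcoe.trans⟩ (ae_restrict_iff' measurableSet_Ioo.compl)

theorem zeroExt_ofBessel {s : ℝ} (w : besselSpace s) : zeroExt (ofBessel s w) = besselInv s w := by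
  refine Lp.ext ?_
  filter_upwards [coeFn_zeroExt (ofBessel s w), mem_besselSpace_iff.1 w.2,
    (ae_restrict_iff' measurableSet_Ioo).1 (coeFn_restrictL (besselInv s w))]
    with x hext hzero hrestrict
  rw [hext]
  by_cases hx : x ∈ Ioo (0 : ℝ) 1
  · rw [indicator_of_mem hx, ofBessel_apply, hrestrict hx]
  · rw [indicator_of_notMem hx, hzero hx]

theorem mulL_bessel_eq {s : ℝ} (w : besselSpace s) :
    mulL volume (bessel s) w = 𝓕 (zeroExt (ofBessel s w)) := by
  rw [zeroExt_ofBessel, besselInv_apply, fourier_fourierInv_eq]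

theorem restrictL_zeroExt (u : L2I) : restrictL (zeroExt u) = u := by
  refine Lp.ext ?_
  filter_upwards [coeFn_restrictL (zeroExt u), ae_restrict_of_ae (coeFn_zeroExt u),
    ae_restrict_mem measurableSet_Ioo] with x hrestrict hext hx
  rw [hrestrict, hext, indicator_of_mem hx]

theorem mem_Htilde_iff_exists_ofBessel {s : ℝ} (hs : 0 ≤ s) {u : L2I} :
    u ∈ Htilde s ↔ ∃ w, ofBessel s w = u := by
  rw [mem_Htilde_iff hs]
  constructor
  · rintro ⟨w, hw⟩
    have hinv : besselInv s w = zeroExt u := by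
      rw [besselInv_apply, hw, fourierInv_fourier_eq]
    have hmem : w ∈ besselSpace s := by
      rw [mem_besselSpace_iff, hinv]
      filter_upwards [coeFn_zeroExt u] with x hx hmem
      rw [hx, indicator_of_notMem hmem]
    exact ⟨⟨w, hmem⟩, by rw [ofBessel_apply, hinv, restrictL_zeroExt]⟩
  · rintro ⟨w, rfl⟩
    exact ⟨w, mulL_bessel_eq w⟩

theorem inner_ofBessel {s : ℝ} (v w : besselSpace s) :
    inner ℂ (ofBessel s v) (ofBessel s w) =
      inner ℂ (mulL volume (bessel s) v) (mulL volume (bessel s) w) := by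
  rw [ofBessel_apply, ofBessel_apply, inner_restrictL]
  · exact (Lp.fourierTransformₗᵢ ℝ ℂ).symm.inner_map_map _ _
  · filter_upwards [mem_besselSpace_iff.1 v.2] with x hx hmem
    exact Or.inl (hx hmem)

/-- The symbol of the form of `A - z` on `besselSpace s`. -/
def shiftedSymbol (s : ℝ) (z : ℂ) (ξ : ℝ) : ℂ := (-(fracSymbol s ξ ^ 2) - z) * bessel s ξ ^ 2

theorem memLp_shiftedSymbol {s : ℝ} (hs : 0 ≤ s) (z : ℂ) :
    MemLp (shiftedSymbol s z) ⊤ (volume : Measure ℝ) := by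
  have hfrac := memLp_fracSymbol_mul_bessel hs
  have hbessel := memLp_bessel hs
  convert (hfrac.mul hfrac (r := ⊤)).neg.sub ((hbessel.mul hbessel (r := ⊤)).const_mul z) using 1
  ext ξ
  simp only [shiftedSymbol, Pi.sub_apply, Pi.neg_apply, Pi.mul_apply]
  ring

theorem inner_mulL_shiftedSymbol {s : ℝ} (hs : 0 ≤ s) (z : ℂ)
    (v w : Lp ℂ 2 (volume : Measure ℝ)) :
    inner ℂ v (mulL volume (shiftedSymbol s z) w) =
      -inner ℂ (mulL volume (star (fracSymbol s * bessel s)) v)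
          (mulL volume (fracSymbol s * bessel s) w) -
        z * inner ℂ (mulL volume (bessel s) v) (mulL volume (bessel s) w) := by
  have hfrac := memLp_fracSymbol_mul_bessel hs
  have hbessel := memLp_bessel hs
  rw [inner_mulL_mulL hfrac.star hfrac, inner_mulL_mulL hbessel hbessel, star_star, star_bessel,
    ← inner_smul_right, ← inner_neg_right, ← inner_sub_right]
  refine congrArg (inner ℂ v) (Lp.ext ?_)
  filter_upwards [coeFn_mulL (memLp_shiftedSymbol hs z) w, coeFn_mulL (hfrac.mul hfrac) w,
    coeFn_mulL (hbessel.mul hbessel) w,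
    Lp.coeFn_sub (-mulL volume (fracSymbol s * bessel s * (fracSymbol s * bessel s)) w)
      (z • mulL volume (bessel s * bessel s) w),
    Lp.coeFn_neg (mulL volume (fracSymbol s * bessel s * (fracSymbol s * bessel s)) w),
    Lp.coeFn_smul z (mulL volume (bessel s * bessel s) w)]
    with ξ hshift hfrac hbessel hsub hneg hsmul
  rw [hshift, hsub, Pi.sub_apply, hneg, Pi.neg_apply, hsmul, Pi.smul_apply, hfrac, hbessel,
    shiftedSymbol, Pi.mul_apply, Pi.mul_apply, Pi.mul_apply, smul_eq_mul]
  ring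

/-- The bounded operator on `besselSpace s` that represents the form of `A - z`. -/
def shiftedForm (s : ℝ) (z : ℂ) : besselSpace s →L[ℂ] besselSpace s :=
  compression (besselSpace s) (mulL volume (shiftedSymbol s z))

theorem inner_shiftedForm {β : ℝ} (hs : β / 2 ∈ Ioo (0 : ℝ) 1)
    (hL : Htilde (β / 2) ≤ (leftRL (β / 2)).domain)
    (hR : Htilde (β / 2) ≤ (rightRL (β / 2)).domain) (z : ℂ) {φ ψ : Htilde (β / 2)}
    {v w : besselSpace (β / 2)} (hw : ofBessel (β / 2) w = φ) (hv : ofBessel (β / 2) v = ψ) :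
    inner ℂ v (shiftedForm (β / 2) z w) =
      form β hL hR φ ψ - z * inner ℂ (ψ : L2I) (φ : L2I) := by
  rw [shiftedForm, inner_compression, inner_mulL_shiftedSymbol hs.1.le, ← hw, ← hv, inner_ofBessel,
    form_eq hs hL hR φ ψ (hw ▸ mulL_bessel_eq w) (hv ▸ mulL_bessel_eq v)]

theorem represents_iff {β : ℝ} (hs : β / 2 ∈ Ioo (0 : ℝ) 1)
    {hL : Htilde (β / 2) ≤ (leftRL (β / 2)).domain}
    {hR : Htilde (β / 2) ≤ (rightRL (β / 2)).domain} (z : ℂ) {φ : Htilde (β / 2)}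
    {w : besselSpace (β / 2)} (hw : ofBessel (β / 2) w = φ) {f : L2I} :
    Represents β hL hR φ f ↔ ∀ v, inner ℂ v (shiftedForm (β / 2) z w) =
      inner ℂ (ofBessel (β / 2) v) (f - z • (φ : L2I)) := by
  constructor
  · intro h v
    have hmem := (mem_Htilde_iff_exists_ofBessel hs.1.le).2 ⟨v, rfl⟩
    rw [inner_shiftedForm hs hL hR z hw (ψ := ⟨_, hmem⟩) rfl, h, inner_sub_right,
      inner_smul_right]
  · intro h ψ
    obtain ⟨v, hv⟩ := (mem_Htilde_iff_exists_ofBessel hs.1.le).1 ψ.2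
    have hψ := h v
    rw [inner_shiftedForm hs hL hR z hw hv, hv, inner_sub_right, inner_smul_right] at hψ
    exact sub_left_inj.1 hψ

theorem mem_graph_operator_iff {β : ℝ} (hs : β / 2 ∈ Ioo (0 : ℝ) 1)
    {hL : Htilde (β / 2) ≤ (leftRL (β / 2)).domain}
    {hR : Htilde (β / 2) ≤ (rightRL (β / 2)).domain} (z : ℂ) (u f : L2I) :
    (u, f) ∈ (operator β hL hR).graph ↔ ∃ w, ofBessel (β / 2) w = u ∧
      ∀ v, inner ℂ v (shiftedForm (β / 2) z w) = inner ℂ (ofBessel (β / 2) v) (f - z • u) := by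
  rw [graph_operator]
  constructor
  · rintro ⟨φ, rfl, h⟩
    obtain ⟨w, hw⟩ := (mem_Htilde_iff_exists_ofBessel hs.1.le).1 φ.2
    exact ⟨w, hw, (represents_iff hs z hw).1 h⟩
  · rintro ⟨w, rfl, h⟩
    have hmem := (mem_Htilde_iff_exists_ofBessel hs.1.le).2 ⟨w, rfl⟩
    exact ⟨⟨_, hmem⟩, rfl, (represents_iff hs z (φ := ⟨_, hmem⟩) rfl).2 h⟩

theorem ofReal_mul_I_cpow {r : ℝ} (hr : 0 ≤ r) (s : ℂ) :
    (r * Complex.I) ^ s = r ^ s * Complex.I ^ s := by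
  rcases hr.eq_or_lt with rfl | hr
  · rcases eq_or_ne s 0 with rfl | hs
    · simp
    · simp [Complex.zero_cpow hs]
  · have hr0 : (r : ℂ) ≠ 0 := Complex.ofReal_ne_zero.2 hr.ne'
    rw [Complex.cpow_def_of_ne_zero (mul_ne_zero hr0 Complex.I_ne_zero),
      Complex.cpow_def_of_ne_zero hr0, Complex.cpow_def_of_ne_zero Complex.I_ne_zero,
      Complex.log_ofReal_mul hr Complex.I_ne_zero, ← Complex.exp_add, ← Complex.ofReal_log hr.le,
      add_mul]

theorem neg_I_cpow_sq (s : ℝ) :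
    -((Complex.I ^ (s : ℂ)) ^ 2) = Complex.exp ((-((1 - s) * π) : ℝ) * Complex.I) := by
  rw [Complex.cpow_def_of_ne_zero Complex.I_ne_zero, Complex.log_I, ← Complex.exp_nat_mul,
    ← Complex.exp_sub_pi_mul_I]
  congr 1
  push_cast
  ring

theorem neg_fracSymbol_sq_of_nonneg (s : ℝ) {ξ : ℝ} (hξ : 0 ≤ ξ) :
    -(fracSymbol s ξ ^ 2) =
      ((2 * π * ξ) ^ (2 * s) : ℝ) * Complex.exp ((-((1 - s) * π) : ℝ) * Complex.I) := by
  have hr : 0 ≤ 2 * π * ξ := by positivity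
  have hbase : 2 * π * Complex.I * ξ = (2 * π * ξ : ℝ) * Complex.I := by
    push_cast
    ring
  rw [fracSymbol, hbase, ofReal_mul_I_cpow hr, mul_pow, ← mul_neg, neg_I_cpow_sq,
    ← Complex.ofReal_cpow hr, ← Complex.ofReal_pow, ← Real.rpow_mul_natCast hr, Nat.cast_ofNat,
    mul_comm s]

theorem exists_neg_fracSymbol_sq_eq (s ξ : ℝ) :
    ∃ α : ℝ, (α = (1 - s) * π ∨ α = -((1 - s) * π)) ∧
      -(fracSymbol s ξ ^ 2) = ((2 * π * |ξ|) ^ (2 * s) : ℝ) * Complex.exp (α * Complex.I) := by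
  rcases le_total 0 ξ with hξ | hξ
  · exact ⟨_, Or.inr rfl, by rw [abs_of_nonneg hξ, neg_fracSymbol_sq_of_nonneg s hξ]⟩
  · refine ⟨_, Or.inl rfl, ?_⟩
    have hconj := congrArg (starRingEnd ℂ) (neg_fracSymbol_sq_of_nonneg s (neg_nonneg.2 hξ))
    rw [map_neg, map_pow, ← fracSymbol_neg, neg_neg] at hconj
    rw [hconj, abs_of_nonpos hξ, map_mul, ← Complex.exp_conj, map_mul, Complex.conj_ofReal,
      Complex.conj_ofReal, Complex.conj_I, Complex.ofReal_neg, neg_mul_neg]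

theorem exists_separating_angle {κ α : ℝ} (hκ : κ ∈ Ico 0 (π / 2)) (hα : κ < |α|)
    (hα' : |α| ≤ π) :
    ∃ γ : ℝ, 0 < Real.cos (γ + κ) ∧ 0 < Real.cos (γ - κ) ∧ Real.cos (γ + α) < 0 := by
  obtain ⟨hκ0, hκ1⟩ := hκ
  obtain ⟨γ, hγ, hγκ⟩ := exists_between
    (max_lt (by linarith) (by linarith) : max (κ - π / 2) (π / 2 - |α|) < π / 2 - κ)
  obtain ⟨hκγ, hαγ⟩ := max_lt_iff.1 hγ
  have hadd : 0 < Real.cos (γ + κ) := Real.cos_pos_of_mem_Ioo ⟨by linarith, by linarith⟩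
  have hsub : 0 < Real.cos (γ - κ) := Real.cos_pos_of_mem_Ioo ⟨by linarith, by linarith⟩
  have hneg : Real.cos (γ + |α|) < 0 :=
    Real.cos_neg_of_pi_div_two_lt_of_lt (by linarith) (by linarith)
  rcases abs_choice α with h | h <;> rw [h] at hneg
  · exact ⟨γ, hadd, hsub, hneg⟩
  · exact ⟨-γ, by rwa [← Real.cos_neg, neg_add, neg_neg],
      by rwa [← Real.cos_neg, neg_sub, sub_neg_eq_add, add_comm],
      by rwa [← Real.cos_neg, neg_add, neg_neg]⟩

theorem re_exp_mul_sub (γ α r : ℝ) (z : ℂ) :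
    (Complex.exp (γ * Complex.I) * (r * Complex.exp (α * Complex.I) - z)).re =
      r * Real.cos (γ + α) - ‖z‖ * Real.cos (γ + z.arg) := by
  have hpolar : Complex.exp (γ * Complex.I) * (r * Complex.exp (α * Complex.I) - z) =
      r * Complex.exp ((γ + α : ℝ) * Complex.I) -
        ‖z‖ * Complex.exp ((γ + z.arg : ℝ) * Complex.I) := by
    conv_lhs => rw [← Complex.norm_mul_exp_arg_mul_I z]
    push_cast
    rw [add_mul, add_mul, Complex.exp_add, Complex.exp_add]
    ring
  rw [hpolar, Complex.sub_re, Complex.re_ofReal_mul, Complex.re_ofReal_mul,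
    Complex.exp_ofReal_mul_I_re, Complex.exp_ofReal_mul_I_re]

theorem one_add_sq_rpow_le {s : ℝ} (hs : s ∈ Icc (0 : ℝ) 1) (ξ : ℝ) :
    (1 + ξ ^ 2) ^ s ≤ 1 + (2 * π * |ξ|) ^ (2 * s) :=
  calc (1 + ξ ^ 2) ^ s ≤ 1 ^ s + (ξ ^ 2) ^ s :=
        Real.rpow_add_le_add_rpow zero_le_one (sq_nonneg ξ) hs.1 hs.2
    _ = 1 + |ξ| ^ (2 * s) := by
        rw [Real.one_rpow, ← sq_abs, ← Real.rpow_natCast_mul (abs_nonneg ξ), Nat.cast_ofNat]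
    _ ≤ 1 + (2 * π * |ξ|) ^ (2 * s) := by
        have hs0 := hs.1
        gcongr
        exact le_mul_of_one_le_left (abs_nonneg _) (by linarith [Real.pi_gt_three])

theorem exists_symbol_coercive {s : ℝ} (hs : s ∈ Ioc (1 / 2 : ℝ) 1) {z : ℂ} (hz : z ≠ 0)
    (harg : (1 - s) * π < |z.arg|) :
    ∃ e : ℂ, ‖e‖ = 1 ∧ ∃ c : ℝ, 0 < c ∧ ∀ ξ : ℝ, c ≤ (e * shiftedSymbol s z ξ).re := by
  obtain ⟨γ, hadd, hsub, hneg⟩ := exists_separating_angle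
    ⟨mul_nonneg (sub_nonneg.2 hs.2) Real.pi_pos.le, by nlinarith [hs.1, Real.pi_pos]⟩ harg
    (Complex.abs_arg_le_pi z)
  have hz' : 0 < -(‖z‖ * Real.cos (γ + z.arg)) :=
    neg_pos.2 (mul_neg_of_pos_of_neg (norm_pos_iff.2 hz) hneg)
  obtain ⟨c, hc, hclt⟩ := exists_between (lt_min (lt_min hadd hsub) hz')
  simp only [lt_min_iff] at hclt
  refine ⟨Complex.exp (γ * Complex.I), Complex.norm_exp_ofReal_mul_I γ, c, hc, fun ξ => ?_⟩
  obtain ⟨α, hα, hsq⟩ := exists_neg_fracSymbol_sq_eq s ξ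
  have hcα : c ≤ Real.cos (γ + α) := by
    rcases hα with rfl | rfl
    · exact hclt.1.1.le
    · exact hclt.1.2.le
  rw [shiftedSymbol, bessel_sq, ← mul_assoc, Complex.re_mul_ofReal, hsq, re_exp_mul_sub,
    Real.rpow_neg (by positivity), ← div_eq_mul_inv, le_div_iff₀ (by positivity)]
  calc c * (1 + ξ ^ 2) ^ s ≤ c * (1 + (2 * π * |ξ|) ^ (2 * s)) := by
        gcongr
        exact one_add_sq_rpow_le ⟨by linarith [hs.1], hs.2⟩ ξ
    _ = (2 * π * |ξ|) ^ (2 * s) * c + c := by ring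
    _ ≤ (2 * π * |ξ|) ^ (2 * s) * Real.cos (γ + α) - ‖z‖ * Real.cos (γ + z.arg) := by
        rw [sub_eq_add_neg]
        gcongr
        exact hclt.2.le

theorem isUnit_shiftedForm {s : ℝ} (hs : s ∈ Ioc (1 / 2 : ℝ) 1) {z : ℂ} (hz : z ≠ 0)
    (harg : (1 - s) * π < |z.arg|) : IsUnit (shiftedForm s z) := by
  obtain ⟨e, he, c, hc, hle⟩ := exists_symbol_coercive hs hz harg
  exact isUnit_compression _ hc fun w _ => mul_norm_sq_le_norm_inner_mulL
    (memLp_shiftedSymbol (by linarith [hs.1]) z) he (.of_forall hle) w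

theorem mem_resolventSet_of_isUnit {H W : Type*} [NormedAddCommGroup H] [InnerProductSpace ℂ H]
    [CompleteSpace H] [NormedAddCommGroup W] [InnerProductSpace ℂ W] [CompleteSpace W]
    {A : H →ₗ.[ℂ] H} {z : ℂ} (ι : W →L[ℂ] H) {N : W →L[ℂ] W} (hN : IsUnit N)
    (hA : ∀ u f, (u, f) ∈ A.graph ↔
      ∃ w, ι w = u ∧ ∀ v, inner ℂ v (N w) = inner ℂ (ι v) (f - z • u)) :
    z ∈ resolventSet A := by
  have hgraph (u g : H) : (u, z • u - g) ∈ A.graph ↔ ∃ w, ι w = u ∧ N w = -ι.adjoint g := by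
    rw [hA]
    refine exists_congr fun w => and_congr_right fun _ => ?_
    rw [ext_iff_inner_left ℂ]
    simp only [sub_sub_cancel_left, inner_neg_right, ContinuousLinearMap.adjoint_inner_right]
  obtain ⟨N, rfl⟩ := hN
  have hright (w : W) : (N : W →L[ℂ] W) ((↑N⁻¹ : W →L[ℂ] W) w) = w :=
    DFunLike.congr_fun N.mul_inv w
  have hleft (w : W) : (↑N⁻¹ : W →L[ℂ] W) ((N : W →L[ℂ] W) w) = w :=
    DFunLike.congr_fun N.inv_mul w
  refine ⟨-(ι ∘L (↑N⁻¹ : W →L[ℂ] W) ∘L ι.adjoint), fun g => ?_, fun u => ?_⟩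
  · have hmem := (hgraph (ι (-(↑N⁻¹ : W →L[ℂ] W) (ι.adjoint g))) g).2
      ⟨_, rfl, by rw [map_neg, hright]⟩
    rw [map_neg] at hmem
    have hdom := LinearPMap.mem_domain_of_mem_graph hmem
    exact ⟨hdom, sub_eq_of_eq_add (sub_eq_iff_eq_add'.1 ((LinearPMap.image_iff hdom).2 hmem))⟩
  · obtain ⟨w, hw, hNw⟩ := (hgraph u (z • u - A u)).1 (by
      rw [sub_sub_cancel]
      exact LinearPMap.mem_graph A u)
    rw [neg_apply, ContinuousLinearMap.comp_apply, ContinuousLinearMap.comp_apply, ← map_neg,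
      ← map_neg, ← hNw, hleft, hw]

end FracOp

end

theorem mainTheorem9_general (β : ℝ) (hβ : β ∈ Set.Ioo (1 : ℝ) 2) :
    ∃ (hL : FracOp.Htilde (β / 2) ≤ (FracOp.leftRL (β / 2)).domain)
      (hR : FracOp.Htilde (β / 2) ≤ (FracOp.rightRL (β / 2)).domain),
      {z : ℂ | z ≠ 0 ∧ (2 - β) * Real.pi / 2 < |z.arg|} ⊆
        FracOp.resolventSet (FracOp.operator β hL hR) := by
  obtain ⟨hβ₁, hβ₂⟩ := hβ
  have hs : β / 2 ∈ Set.Ioo (0 : ℝ) 1 := ⟨by linarith, by linarith⟩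
  refine ⟨FracOp.Htilde_le_domain_leftRL hs, FracOp.Htilde_le_domain_rightRL hs, ?_⟩
  rintro z ⟨hz, harg⟩
  have hunit : IsUnit (FracOp.shiftedForm (β / 2) z) :=
    FracOp.isUnit_shiftedForm ⟨by linarith, by linarith⟩ hz (by linarith)
  exact FracOp.mem_resolventSet_of_isUnit (FracOp.ofBessel (β / 2)) hunit
    (FracOp.mem_graph_operator_iff hs z)

theorem mainTheorem9 (β : ℝ) (hβ : β ∈ Set.Ioo (3 / 2 : ℝ) 2) :
    ∃ (hL : FracOp.Htilde (β / 2) ≤ (FracOp.leftRL (β / 2)).domain)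
      (hR : FracOp.Htilde (β / 2) ≤ (FracOp.rightRL (β / 2)).domain),
      ∀ θ ∈ Set.Ioo ((2 - β) * Real.pi / 2) (Real.pi / 4),
        {z : ℂ | z ≠ 0 ∧ θ ≤ |z.arg| ∧ |z.arg| ≤ Real.pi} ⊆
          FracOp.resolventSet (FracOp.operator β hL hR) := by
  obtain ⟨hL, hR, hsub⟩ := mainTheorem9_general β ⟨by linarith [hβ.1], hβ.2⟩
  exact ⟨hL, hR, fun θ hθ z hz => hsub ⟨hz.1, hθ.1.trans_le hz.2.1⟩⟩
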